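/- Let $\{X_{n,j}: j\le n,\ n\in\mathbb N\}$ be a triangular array of non-negative random variables, independent within each row, whose distributions $\mathcal P_{n,j}$ are non-atomic, and let $\{c_{n,j}: j\le n,\ n\in\mathbb N\}$ be positive constants such that ($H_1$) as $n\to\infty$, $d_n:=\sum_{j=1}^n c_{n,j}\to\infty$, $\max_{j\le n}c_{n,j}/d_n\to0$, and the measures $\mu_n:=\sum_{j=1}^n\frac{c_{n,j}}{d_n}\delta_{j/n}$ on $[0,1]$ converge weakly to a measure $\mu$; ($H_2$) there is a non-atomic measure $\gamma$ on $\mathbb R_+=(0,\infty]$ (in particular without atom at $+\infty$), finite on $[t,\infty]$ for every $t>0$, such that for every $t>0$ and every non-negative continuous function $f$ on $(0,\infty]$ with support in $[t,\infty]$, $$\max_{j\le n}\Big|\frac{d_n}{c_{n,j}}\int f\,d\mathcal P_{n,j}-\int f\,d\gamma\Big|\longrightarrow0\qquad(n\to\infty).$$ Let $\zeta_n=\sum_{j=1}^n\delta_{(j/n,\,X_{n,j})}$, and let $\zeta$ be a Poisson point process on $[0,1]\times\mathbb R_+$ with intensity measure $\mu\times\gamma$. For a configuration $\varkappa\subset[0,1]\times(0,\infty)$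 with finitely many points in $[0,1]\times[t,\infty)$ for each $t>0$, put $$M(\varkappa)=\max\{x:(t,x)\in\varkappa\},\qquad L(\varkappa)(t)=\max\{x:(s,x)\in\varkappa,\ s\ge t\}\quad(t\in[0,1]),$$ with $\max\emptyset=0$, and let $A(\varkappa)$ be the time coordinate $t$ of the point $(t,x)\in\varkappa$ with the largest $x$ (the smallest such time in case of ties). The function $L(\varkappa)$ is left-continuous with right limits; let $\mathbb D=\mathbb D[0,1]$ be the space of all real functions on $[0,1]$ that are left-continuous with right limits, with the Skorokhod ($J_1$) topology. Then the following convergences in distribution hold as $n\to\infty$. 1. If $\gamma(\mathbb R_+)=\infty$ (so that $\zeta$ is almost surely non-empty and $A(\zeta)$ is defined), then $\frac1n\operatorname{argmax}_{j\le n}\{X_{n,j}\}\Longrightarrow A(\zeta)$. 2. $\max_{j\le n}\{X_{n,j}\}\Longrightarrow M(\zeta)$. 3. If $\mu$ is non-atomic, then $L(\zeta_n)\Longrightarrow L(\zeta)$ in $\mathbb D$. -/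

import Mathlib

open MeasureTheory ProbabilityTheory Filter Topology Set
open scoped ENNReal NNReal unitInterval

namespace Ladder

/-! ### The array -/

/-- The point `j / n` of `[0,1]`; the index `j = 1, …, n` is represented by `i : Fin n`, `j = i + 1`. -/
noncomputable def gridPoint (n : ℕ) (i : Fin n) : I :=
  ⟨((i : ℝ) + 1) / n, by
    have h : ((i : ℝ) + 1) ≤ n := by exact_mod_cast i.isLt
    exact ⟨by positivity, div_le_one_of_le₀ h (by positivity)⟩⟩

/-- The row sum `d_n = ∑_{j ≤ n} c_{n,j}`. -/
noncomputable def rowSum (c : (n : ℕ) → Fin n → ℝ) (n : ℕ) : ℝ := ∑ i, c n i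

/-- The measure `μ_n = ∑_{j ≤ n} (c_{n,j} / d_n) δ_{j/n}` on `[0,1]`. -/
noncomputable def weightMeasure (c : (n : ℕ) → Fin n → ℝ) (n : ℕ) : FiniteMeasure I :=
  ∑ i, (c n i / rowSum c n).toNNReal • (diracProba (gridPoint n i)).toFiniteMeasure

/-- Nonnegative continuous functions on `(0,∞]` with support in the compact set `[t,∞]` (`t > 0`).
Such a function is given by its restriction to the finite points, extended by zero to `(-∞,0]`;
continuity at the point `+∞` is the existence of a finite limit at `+∞`. -/
def testFunctions (t : ℝ) : Set (ℝ → ℝ) :=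
  {f | Continuous f ∧ (∀ x, 0 ≤ f x) ∧ (∀ x < t, f x = 0) ∧ ∃ l : ℝ, Tendsto f atTop (𝓝 l)}

/-- The index `j ∈ {1, …, n}` of the largest of `x_1, …, x_n` (the least such index if there are
ties; `0` if `n = 0`). -/
noncomputable def argmaxIndex {n : ℕ} (x : Fin n → ℝ) : ℕ :=
  sInf {j : ℕ | ∃ i : Fin n, j = (i : ℕ) + 1 ∧ ∀ k, x k ≤ x i}

/-! ### Configurations -/

/-- Locally finite configurations in `[0,1] × (0,∞)`. -/
structure Config where
  carrier : Set (I × ℝ)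
  pos : ∀ p ∈ carrier, 0 < p.2
  locallyFinite : ∀ t : ℝ, 0 < t → (carrier ∩ {p | t ≤ p.2}).Finite

/-- The configuration of the points `(j/n, x_j)`, `j ≤ n`, that lie in `[0,1] × (0,∞)`. -/
noncomputable def empiricalConfig {n : ℕ} (x : Fin n → ℝ) : Config where
  carrier := {p | ∃ i : Fin n, p = (gridPoint n i, x i) ∧ 0 < x i}
  pos := by
    rintro p ⟨i, rfl, hi⟩
    exact hi
  locallyFinite := fun t _ => by
    refine Set.Finite.subset (Set.finite_range fun i : Fin n => (gridPoint n i, x i)) ?_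
    rintro p ⟨⟨i, rfl, _⟩, _⟩
    exact ⟨i, rfl⟩

/-- The number of points of a configuration in `B`. -/
noncomputable def Config.count (κ : Config) (B : Set (I × ℝ)) : ℕ := (κ.carrier ∩ B).ncard

/-- `B` is a Borel set that is relatively compact in `[0,1] × (0,∞]`. -/
def IsBoundedBorel (B : Set (I × ℝ)) : Prop :=
  MeasurableSet B ∧ ∃ t : ℝ, 0 < t ∧ B ⊆ {p | t ≤ p.2}

/-- `ζ` is, under `Q`, a Poisson point process on `[0,1] × (0,∞)` with intensity measure `Λ`. -/
structure IsPoissonProcess {Ω : Type*} [MeasurableSpace Ω] (Q : Measure Ω) (ζ : Ω → Config)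
    (Λ : Measure (I × ℝ)) : Prop where
  measurable_count : ∀ B, IsBoundedBorel B → Measurable fun ω => (ζ ω).count B
  law_count : ∀ B, IsBoundedBorel B →
    Q.map (fun ω => (ζ ω).count B) = poissonMeasure (Λ B).toNNReal
  indep_count : ∀ (k : ℕ) (B : Fin k → Set (I × ℝ)), (∀ i, IsBoundedBorel (B i)) →
    Pairwise (fun i j => Disjoint (B i) (B j)) → iIndepFun (fun i ω => (ζ ω).count (B i)) Q

/-- `M(κ) = max {x | (t,x) ∈ κ}`, and `0` for the empty configuration. -/
noncomputable def Config.height (κ : Config) : ℝ := sSup {x | ∃ t, (t, x) ∈ κ.carrier}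

/-- `A(κ)`, the time `t ∈ [0,1]` of the point `(t,x) ∈ κ` with the largest `x` (the least such time
if there are ties; `0` for the empty configuration). -/
noncomputable def Config.argmaxTime (κ : Config) : ℝ :=
  sInf {u : ℝ | ∃ t : I, (t : ℝ) = u ∧ (t, κ.height) ∈ κ.carrier}

/-- `L(κ)(t) = max {x | (s,x) ∈ κ, s ≥ t}`, and `0` if there is no such point. -/
noncomputable def Config.ladderFun (κ : Config) (t : I) : ℝ :=
  sSup {x | ∃ s, t ≤ s ∧ (s, x) ∈ κ.carrier}

/-! ### The Skorokhod space -/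

/-- The space `D[0,1]` of functions without discontinuities of the second kind, normalised to be
left-continuous (with right limits). -/
structure SkorokhodSpace where
  toFun : I → ℝ
  leftCont : ∀ t, ContinuousWithinAt toFun (Iic t) t
  rightLim : ∀ t, ∃ l : ℝ, Tendsto toFun (𝓝[>] t) (𝓝 l)

/-- The Skorokhod (`J₁`) distance: the infimum over the increasing bijections `φ` of `[0,1]` of
`max (sup_t |φ(t) - t|) (sup_t |f(t) - g(φ(t))|)`. -/
noncomputable def skorokhodDist (f g : SkorokhodSpace) : ℝ≥0∞ :=
  ⨅ φ : I ≃o I, max (⨆ t, edist (φ t) t) (⨆ t, edist (f.toFun t) (g.toFun (φ t)))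

theorem skorokhodDist_self (f : SkorokhodSpace) : skorokhodDist f f = 0 := by
  refine le_antisymm ?_ zero_le
  refine (iInf_le _ (OrderIso.refl I)).trans ?_
  simp

theorem skorokhodDist_le_comm (f g : SkorokhodSpace) : skorokhodDist f g ≤ skorokhodDist g f := by
  refine le_iInf fun φ => (iInf_le _ φ.symm).trans ?_
  refine max_le_max (iSup_le fun t => ?_) (iSup_le fun t => ?_)
  · refine le_trans (le_of_eq ?_) (le_iSup (fun t => edist (φ t) t) (φ.symm t))
    rw [edist_comm]
    simp
  · refine le_trans (le_of_eq ?_)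
      (le_iSup (fun t => edist (g.toFun t) (f.toFun (φ t))) (φ.symm t))
    rw [edist_comm]
    simp

theorem skorokhodDist_triangle (f g h : SkorokhodSpace) :
    skorokhodDist f h ≤ skorokhodDist f g + skorokhodDist g h := by
  refine ENNReal.le_iInf_add_iInf fun φ ψ => (iInf_le _ (φ.trans ψ)).trans ?_
  refine max_le (iSup_le fun t => ?_) (iSup_le fun t => ?_)
  · refine (edist_triangle _ (φ t) _).trans ?_
    rw [add_comm]
    refine add_le_add ?_ ?_
    · exact (le_iSup (fun t => edist (φ t) t) t).trans (le_max_left _ _)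
    · exact (le_iSup (fun t => edist (ψ t) t) (φ t)).trans (le_max_left _ _)
  · refine (edist_triangle _ (g.toFun (φ t)) _).trans (add_le_add ?_ ?_)
    · exact (le_iSup (fun t => edist (f.toFun t) (g.toFun (φ t))) t).trans (le_max_right _ _)
    · exact (le_iSup (fun t => edist (g.toFun t) (h.toFun (ψ t))) (φ t)).trans
        (le_max_right _ _)

/-- The Skorokhod topology on `D[0,1]`. -/
noncomputable instance : PseudoEMetricSpace SkorokhodSpace where
  edist := skorokhodDist
  edist_self := skorokhodDist_self
  edist_comm f g := le_antisymm (skorokhodDist_le_comm f g) (skorokhodDist_le_comm g f)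
  edist_triangle := skorokhodDist_triangle

noncomputable instance : MeasurableSpace SkorokhodSpace := borel SkorokhodSpace

instance : BorelSpace SkorokhodSpace := ⟨rfl⟩

/-! ### The ladder map as a map into the Skorokhod space -/

theorem Config.bddAbove (κ : Config) : BddAbove {x | ∃ t, (t, x) ∈ κ.carrier} := by
  obtain ⟨b, hb⟩ := ((κ.locallyFinite 1 one_pos).image Prod.snd).bddAbove
  refine ⟨max b 1, ?_⟩
  rintro x ⟨t, hx⟩
  by_cases h : 1 ≤ x
  · exact (hb ⟨(t, x), ⟨hx, h⟩, rfl⟩).trans (le_max_left _ _)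
  · exact (not_le.1 h).le.trans (le_max_right _ _)

theorem Config.bddAbove_from (κ : Config) (t : I) :
    BddAbove {x | ∃ s, t ≤ s ∧ (s, x) ∈ κ.carrier} := by
  refine κ.bddAbove.mono ?_
  rintro x ⟨s, _, hx⟩
  exact ⟨s, hx⟩

theorem Config.ladderFun_nonneg (κ : Config) (t : I) : 0 ≤ κ.ladderFun t := by
  refine Real.sSup_nonneg ?_
  rintro x ⟨s, _, hx⟩
  exact (κ.pos _ hx).le

theorem Config.ladderFun_antitone (κ : Config) : Antitone κ.ladderFun := by
  intro t u htu
  refine Real.sSup_le ?_ (κ.ladderFun_nonneg t)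
  rintro x ⟨s, hs, hx⟩
  exact le_csSup (κ.bddAbove_from t) ⟨s, htu.trans hs, hx⟩

theorem Config.ladderFun_leftCont (κ : Config) (t : I) :
    ContinuousWithinAt κ.ladderFun (Iic t) t := by
  refine tendsto_order.2 ⟨fun a ha => ?_, fun a ha => ?_⟩
  · filter_upwards [self_mem_nhdsWithin] with u hu
    exact ha.trans_le (κ.ladderFun_antitone hu)
  · obtain ⟨b, hb, hba⟩ := exists_between ha
    have hb0 : 0 < b := (κ.ladderFun_nonneg t).trans_lt hb
    -- the finitely many points of height at least `b` all lie strictly before `t`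
    have hev : ∀ᶠ u in 𝓝 t, ∀ p ∈ κ.carrier ∩ {p | b ≤ p.2}, p.1 < u := by
      refine (Filter.eventually_all_finite (κ.locallyFinite b hb0)).2 fun p hp => ?_
      refine lt_mem_nhds ?_
      by_contra h
      exact absurd (hp.2.trans (le_csSup (κ.bddAbove_from t) ⟨p.1, not_lt.1 h, hp.1⟩))
        (not_le.2 hb)
    filter_upwards [nhdsWithin_le_nhds hev] with u hu
    refine lt_of_le_of_lt (Real.sSup_le ?_ hb0.le) hba
    rintro x ⟨s, hs, hx⟩
    by_contra h
    exact absurd (hu (s, x) ⟨hx, (not_le.1 h).le⟩) (not_lt.2 hs)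

/-- The ladder map `L` from configurations to `D[0,1]`. -/
noncomputable def Config.ladder (κ : Config) : SkorokhodSpace where
  toFun := κ.ladderFun
  leftCont := κ.ladderFun_leftCont
  rightLim := fun t => by
    refine ⟨_, κ.ladderFun_antitone.tendsto_nhdsGT t⟩

end Ladder

/-! Convergence of point processes is not needed: everything is expressed through `Config.maxOn κ
B`, the largest height over a set `B` of times. For `a > 0` the event `maxOn B < a` says that `B ×ˢ
Ici a` contains no point. For the Poisson process its probability is `exp (-μ(B) γ[a,∞))`. For row
`n` it is a product of factors `1 - P(X_{n,j} ≥ a)` over the indices with `j/n ∈ B`. By `H₂` the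
probabilities `P(X_{n,j} ≥ a)` are uniformly close, relative to `c_{n,j}/d_n`, to `c_{n,j}/d_n ·
γ[a,∞)`; they are uniformly small, and their sum tends to `μ(B) γ[a,∞)` when `μ(∂B) = 0`, so the
product has the Poisson limit. Maxima over disjoint sets are independent on both sides, whence joint
convergence (`tendstoInDistribution_maxOn_pi`).

The height is the case `B = [0,1]`. For the argmax, `A < t` means that the maximum over `[t,1]` does
not exceed the maximum over `[0,t)`. This is a closed condition on two independent maxima, and its
boundary, a tie, is null: one of the two time sets has positive `μ`-mass, and since `γ` is infinite
and diffuse the maximum over it has no atoms.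

For the ladder, cut `(0,1]` into `k` cells and keep only the maximum of each cell, placed at the
right end of the cell. The resulting ladder is a continuous function of the vector of cell maxima,
so it converges for fixed `k`. If the points of height at least `ε` lie in distinct cells and off
the edges, a time change moving times by at most `2/k` carries them to the right ends, and the
Skorokhod error is at most `max (2/k) ε`. First and second moment bounds make the exceptional
probability at most about `∑ (μ(cell) Γ)² + μ(edge) Γ`, where `Γ = γ[ε,∞)`; this vanishes as `k → ∞`
because `μ` is diffuse. `tendstoInDistribution_of_approximation` then passes to the limit. -/

namespace Ladder

/-! ### Maxima over subsets of the time interval -/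

namespace Config

/-- The largest height of a point of `κ` with time coordinate in `B`, and `0` if there is none. -/
noncomputable def maxOn (κ : Config) (B : Set I) : ℝ := sSup {x | ∃ s ∈ B, (s, x) ∈ κ.carrier}

variable (κ : Config) (B : Set I)

theorem height_eq_maxOn : κ.height = κ.maxOn univ := by simp [height, maxOn]

theorem ladderFun_eq_maxOn (t : I) : κ.ladderFun t = κ.maxOn (Ici t) := rfl

theorem maxOn_nonneg : 0 ≤ κ.maxOn B := by
  refine Real.sSup_nonneg ?_
  rintro x ⟨s, _, hx⟩
  exact (κ.pos _ hx).le

variable {κ B}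

theorem le_maxOn {p : I × ℝ} (hp : p ∈ κ.carrier) (hB : p.1 ∈ B) : p.2 ≤ κ.maxOn B := by
  refine le_csSup (κ.bddAbove.mono ?_) ⟨p.1, hB, hp⟩
  rintro x ⟨s, _, hx⟩
  exact ⟨s, hx⟩

theorem maxOn_le_iff {a : ℝ} (ha : 0 ≤ a) :
    κ.maxOn B ≤ a ↔ ∀ p ∈ κ.carrier, p.1 ∈ B → p.2 ≤ a := by
  refine ⟨fun h p hp hB => (le_maxOn hp hB).trans h, fun h => Real.sSup_le ?_ ha⟩
  rintro x ⟨s, hs, hx⟩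
  exact h _ hx hs

/-- Only finitely many points lie above half of a positive supremum, so the supremum is attained
among them. -/
theorem exists_mem_of_maxOn_pos (h : 0 < κ.maxOn B) :
    ∃ s ∈ B, (s, κ.maxOn B) ∈ κ.carrier := by
  have hfin : (κ.carrier ∩ {p | κ.maxOn B / 2 ≤ p.2} ∩ {p | p.1 ∈ B}).Finite :=
    (κ.locallyFinite _ (half_pos h)).subset inter_subset_left
  have hne : (κ.carrier ∩ {p | κ.maxOn B / 2 ≤ p.2} ∩ {p | p.1 ∈ B}).Nonempty := by
    by_contra hemp
    rw [not_nonempty_iff_eq_empty] at hemp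
    have : κ.maxOn B ≤ κ.maxOn B / 2 := by
      refine (maxOn_le_iff (half_pos h).le).2 fun p hp hB => ?_
      by_contra hlt
      exact (hemp ▸ (⟨⟨hp, (not_le.1 hlt).le⟩, hB⟩ :
        p ∈ κ.carrier ∩ {p | κ.maxOn B / 2 ≤ p.2} ∩ {p | p.1 ∈ B}) : p ∈ (∅ : Set (I × ℝ)))
    linarith
  obtain ⟨p, ⟨⟨hp, hp2⟩, hpB⟩, hmax⟩ := Set.exists_max_image _ Prod.snd hfin hne
  have heq : κ.maxOn B = p.2 := by
    refine le_antisymm ((maxOn_le_iff (κ.pos p hp).le).2 fun q hq hqB => ?_) (le_maxOn hp hpB)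
    by_cases hq2 : κ.maxOn B / 2 ≤ q.2
    · exact hmax q ⟨⟨hq, hq2⟩, hqB⟩
    · exact (not_le.1 hq2).le.trans hp2
  exact ⟨p.1, hpB, heq ▸ hp⟩

theorem maxOn_lt_iff {a : ℝ} (ha : 0 < a) :
    κ.maxOn B < a ↔ ∀ p ∈ κ.carrier, p.1 ∈ B → p.2 < a := by
  refine ⟨fun h p hp hB => (le_maxOn hp hB).trans_lt h, fun h => ?_⟩
  rcases (κ.maxOn_nonneg B).eq_or_lt with h0 | h0
  · rwa [← h0]
  · obtain ⟨s, hs, hx⟩ := exists_mem_of_maxOn_pos h0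
    exact h _ hx hs

theorem maxOn_mono {B' : Set I} (h : B ⊆ B') : κ.maxOn B ≤ κ.maxOn B' :=
  (maxOn_le_iff (κ.maxOn_nonneg _)).2 fun _ hp hB => le_maxOn hp (h hB)

theorem finite_inter_prod_Ici {a : ℝ} (ha : 0 < a) : (κ.carrier ∩ B ×ˢ Ici a).Finite :=
  (κ.locallyFinite a ha).subset fun _ hp => ⟨hp.1, hp.2.2⟩

/-- The bridge from maxima to void events. Positivity of `a` makes the set finite; `ncard` would
also vanish on an infinite set. -/
theorem maxOn_lt_iff_count_eq_zero {a : ℝ} (ha : 0 < a) :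
    κ.maxOn B < a ↔ κ.count (B ×ˢ Ici a) = 0 := by
  rw [count, Set.ncard_eq_zero (finite_inter_prod_Ici ha), maxOn_lt_iff ha,
    Set.eq_empty_iff_forall_notMem]
  refine ⟨fun h p hp => absurd hp.2.2 (not_le.2 (h p hp.1 hp.2.1)), fun h p hp hB => ?_⟩
  by_contra hlt
  exact h p ⟨hp, hB, not_lt.1 hlt⟩

/-- The time of the highest point precedes `t` exactly when the maximum before `t` is at least the
maximum from `t` onwards. -/
theorem argmaxTime_lt_iff {t : ℝ} (ht : 0 < t) :
    κ.argmaxTime < t ↔ κ.maxOn {s | t ≤ (s : ℝ)} ≤ κ.maxOn {s | (s : ℝ) < t} := by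
  rcases (κ.maxOn_nonneg univ).eq_or_lt with h0 | h0
  -- Empty configuration: the time is `sInf ∅ = 0`, which is before `t` because `0 < t`, and both
  -- maxima are `0`.
  · have hB : ∀ B, κ.maxOn B = 0 := fun B =>
      le_antisymm (h0 ▸ maxOn_mono (subset_univ B)) (κ.maxOn_nonneg B)
    have hemp : {u : ℝ | ∃ s : I, (s : ℝ) = u ∧ (s, κ.height) ∈ κ.carrier} = ∅ := by
      refine Set.eq_empty_of_forall_notMem ?_
      rintro u ⟨s, _, hs⟩
      have := κ.pos _ hs
      rw [height_eq_maxOn, hB] at this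
      exact lt_irrefl _ this
    simp only [argmaxTime, hemp, Real.sInf_empty, hB, le_refl, ht]
  · have hfin : {u : ℝ | ∃ s : I, (s : ℝ) = u ∧ (s, κ.height) ∈ κ.carrier}.Finite := by
      rw [height_eq_maxOn]
      refine ((κ.locallyFinite _ h0).image fun p => (p.1 : ℝ)).subset ?_
      rintro u ⟨s, rfl, hs⟩
      exact ⟨(s, κ.maxOn univ), ⟨hs, show κ.maxOn univ ≤ κ.maxOn univ from le_rfl⟩, rfl⟩
    have hne : {u : ℝ | ∃ s : I, (s : ℝ) = u ∧ (s, κ.height) ∈ κ.carrier}.Nonempty := by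
      obtain ⟨s, _, hs⟩ := exists_mem_of_maxOn_pos h0
      exact ⟨s, s, rfl, by rwa [height_eq_maxOn]⟩
    rw [argmaxTime, csInf_lt_iff hfin.bddBelow hne]
    constructor
    · rintro ⟨u, ⟨s, rfl, hs⟩, hst⟩
      refine (maxOn_mono (subset_univ _)).trans ?_
      rw [← height_eq_maxOn]
      exact le_maxOn hs hst
    · intro h
      obtain ⟨s, _, hs⟩ := exists_mem_of_maxOn_pos h0
      have heq : κ.maxOn {s | (s : ℝ) < t} = κ.maxOn univ := by
        refine le_antisymm (maxOn_mono (subset_univ _)) ?_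
        by_cases hst : (s : ℝ) < t
        · exact le_maxOn hs hst
        · exact (le_maxOn (B := {s | t ≤ (s : ℝ)}) hs (not_lt.1 hst)).trans h
      obtain ⟨r, hr, hr'⟩ := exists_mem_of_maxOn_pos (heq ▸ h0)
      exact ⟨r, ⟨r, rfl, by rwa [height_eq_maxOn, ← heq]⟩, hr⟩

end Config

/-! ### Empirical configurations -/

/-- The entries discarded by `empiricalConfig` are nonpositive, hence invisible to levels `a ≥ 0`.
-/
theorem maxOn_empiricalConfig_le_iff {n : ℕ} {x : Fin n → ℝ} {B : Set I} {a : ℝ} (ha : 0 ≤ a) :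
    (empiricalConfig x).maxOn B ≤ a ↔ ∀ i, gridPoint n i ∈ B → x i ≤ a := by
  rw [Config.maxOn_le_iff ha]
  constructor
  · intro h i hi
    by_cases hx : 0 < x i
    · exact h _ ⟨i, rfl, hx⟩ hi
    · exact (not_lt.1 hx).trans ha
  · rintro h p ⟨i, rfl, _⟩ hi
    exact h i hi

theorem maxOn_empiricalConfig_lt_iff {n : ℕ} {x : Fin n → ℝ} {B : Set I} {a : ℝ} (ha : 0 < a) :
    (empiricalConfig x).maxOn B < a ↔ ∀ i, gridPoint n i ∈ B → x i < a := by
  rw [Config.maxOn_lt_iff ha]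
  constructor
  · intro h i hi
    by_cases hx : 0 < x i
    · exact h _ ⟨i, rfl, hx⟩ hi
    · exact (not_lt.1 hx).trans_lt ha
  · rintro h p ⟨i, rfl, _⟩ hi
    exact h i hi

theorem le_maxOn_empiricalConfig {n : ℕ} {x : Fin n → ℝ} {B : Set I} {i : Fin n}
    (hi : gridPoint n i ∈ B) : x i ≤ (empiricalConfig x).maxOn B :=
  (maxOn_empiricalConfig_le_iff (Config.maxOn_nonneg _ _)).1 le_rfl i hi

theorem iSup_eq_height_empiricalConfig {n : ℕ} {x : Fin n → ℝ} (hx : ∀ i, 0 ≤ x i) :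
    ⨆ i, x i = (empiricalConfig x).height := by
  rw [Config.height_eq_maxOn]
  refine le_antisymm ?_ ?_
  · exact Real.iSup_le (fun i => le_maxOn_empiricalConfig (mem_univ _)) (Config.maxOn_nonneg _ _)
  · exact (maxOn_empiricalConfig_le_iff (Real.iSup_nonneg hx)).2
      fun i _ => le_ciSup (Set.finite_range x).bddAbove i

/-- The maximum over a set of times depends on the heights in a `1`-Lipschitz way. -/
theorem maxOn_empiricalConfig_le_add {n : ℕ} {x y : Fin n → ℝ} {r : ℝ}
    (h : ∀ i, x i ≤ y i + r) (hr : 0 ≤ r) (B : Set I) :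
    (empiricalConfig x).maxOn B ≤ (empiricalConfig y).maxOn B + r :=
  (maxOn_empiricalConfig_le_iff (add_nonneg (Config.maxOn_nonneg _ _) hr)).2 fun i hi =>
    (h i).trans (by gcongr; exact le_maxOn_empiricalConfig hi)

theorem abs_maxOn_empiricalConfig_sub_le {n : ℕ} {x y : Fin n → ℝ} {r : ℝ}
    (h : ∀ i, |x i - y i| ≤ r) (hr : 0 ≤ r) (B : Set I) :
    |(empiricalConfig x).maxOn B - (empiricalConfig y).maxOn B| ≤ r := by
  have h1 := maxOn_empiricalConfig_le_add (x := x) (y := y)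
    (fun i => by linarith [(abs_le.1 (h i)).2]) hr B
  have h2 := maxOn_empiricalConfig_le_add (x := y) (y := x)
    (fun i => by linarith [(abs_le.1 (h i)).1]) hr B
  rw [abs_le]
  constructor <;> linarith

/-- The analogue of `Config.argmaxTime_lt_iff` for a row. A grid point before `t` is required
because of the zero row: there the configuration is empty and both maxima are `0`, while the index
is still `1`. -/
theorem argmaxIndex_div_lt_iff {n : ℕ} {x : Fin n → ℝ} (hx : ∀ i, 0 ≤ x i) {t : ℝ}
    (hn : ∃ i : Fin n, (gridPoint n i : ℝ) < t) :
    (argmaxIndex x : ℝ) / n < t ↔ (empiricalConfig x).maxOn {s | t ≤ (s : ℝ)} ≤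
      (empiricalConfig x).maxOn {s | (s : ℝ) < t} := by
  obtain ⟨i₀, hi₀⟩ := hn
  have hmemgrid : ∀ i : Fin n, (gridPoint n i : ℝ) = ((((i : ℕ) + 1 : ℕ) : ℝ)) / n := by
    intro i; simp [gridPoint]
  obtain ⟨m, -, hm⟩ := Finset.exists_max_image Finset.univ x ⟨i₀, Finset.mem_univ _⟩
  obtain ⟨i, hi, himax⟩ : argmaxIndex x ∈ {j : ℕ | ∃ i : Fin n, j = (i : ℕ) + 1 ∧ ∀ k, x k ≤ x i} :=
    Nat.sInf_mem ⟨_, m, rfl, fun k => hm k (Finset.mem_univ _)⟩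
  rw [hi, ← hmemgrid]
  constructor
  · intro hit
    refine (maxOn_empiricalConfig_le_iff (Config.maxOn_nonneg _ _)).2 fun k _ => ?_
    exact (himax k).trans (le_maxOn_empiricalConfig hit)
  · intro h
    by_contra hit
    have h1 : x i ≤ (empiricalConfig x).maxOn {s | (s : ℝ) < t} :=
      (le_maxOn_empiricalConfig (B := {s | t ≤ (s : ℝ)}) (not_lt.1 hit)).trans h
    obtain ⟨j, hj, hji⟩ : ∃ j : Fin n, (gridPoint n j : ℝ) < t ∧ x i ≤ x j := by
      by_contra hcon
      push Not at hcon
      -- If the overall maximum is `0`, any index before `t`, such as `i₀`, attains it; otherwise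
      -- all values before `t` being smaller forces the maximum before `t` to be strictly smaller.
      rcases (hx i).eq_or_lt with h0 | h0
      · exact absurd (hcon i₀ hi₀) (not_lt.2 (h0 ▸ hx i₀))
      · exact absurd h1 (not_le.2 ((maxOn_empiricalConfig_lt_iff h0).2 fun j hj => hcon j hj))
    have hle : argmaxIndex x ≤ (j : ℕ) + 1 :=
      Nat.sInf_le ⟨j, rfl, fun k => (himax k).trans hji⟩
    rw [hi] at hle
    refine hit (lt_of_le_of_lt ?_ hj)
    rw [hmemgrid, hmemgrid]
    gcongr

/-! ### Tails of the array -/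

/-- The continuous function that vanishes below `u`, is `1` above `v` and is affine in between. -/
noncomputable def ramp (u v x : ℝ) : ℝ := max 0 (min 1 ((x - u) / (v - u)))

theorem continuous_ramp (u v : ℝ) : Continuous (ramp u v) := by
  unfold ramp; fun_prop

theorem ramp_nonneg (u v x : ℝ) : 0 ≤ ramp u v x := le_max_left _ _

theorem ramp_le_one (u v x : ℝ) : ramp u v x ≤ 1 := max_le zero_le_one (min_le_left _ _)

theorem ramp_of_le {u v x : ℝ} (huv : u < v) (hx : x ≤ u) : ramp u v x = 0 := by
  refine max_eq_left ((min_le_right _ _).trans ?_)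
  exact div_nonpos_of_nonpos_of_nonneg (by linarith) (by linarith)

theorem ramp_of_ge {u v x : ℝ} (huv : u < v) (hx : v ≤ x) : ramp u v x = 1 := by
  have : 1 ≤ (x - u) / (v - u) := by
    rw [le_div_iff₀ (by linarith)]; linarith
  rw [ramp, min_eq_left this, max_eq_right zero_le_one]

theorem ramp_mem_testFunctions {u v : ℝ} (huv : u < v) : ramp u v ∈ testFunctions u := by
  refine ⟨continuous_ramp u v, ramp_nonneg u v, fun x hx => ramp_of_le huv hx.le, 1, ?_⟩
  refine tendsto_const_nhds.congr' ?_
  filter_upwards [eventually_ge_atTop v] with x hx using (ramp_of_ge huv hx).symm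

theorem ramp_le_indicator {u v : ℝ} (huv : u < v) (x : ℝ) :
    ramp u v x ≤ (Ici u).indicator 1 x := by
  by_cases hx : u ≤ x
  · rw [indicator_of_mem (show x ∈ Ici u from hx)]
    exact ramp_le_one u v x
  · rw [indicator_of_notMem (show x ∉ Ici u from hx), ramp_of_le huv (not_le.1 hx).le]

theorem indicator_le_ramp {u v : ℝ} (huv : u < v) (x : ℝ) :
    (Ici v).indicator 1 x ≤ ramp u v x := by
  by_cases hx : v ≤ x
  · rw [indicator_of_mem (show x ∈ Ici v from hx), ramp_of_ge huv hx]
    exact le_rfl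
  · rw [indicator_of_notMem (show x ∉ Ici v from hx)]
    exact ramp_nonneg u v x

section

variable {ν : Measure ℝ} {u v : ℝ}

theorem integrable_indicator_Ici (h : ν (Ici u) < ∞) :
    Integrable ((Ici u).indicator (1 : ℝ → ℝ)) ν :=
  (integrable_indicator_iff measurableSet_Ici).2 (integrableOn_const h.ne)

theorem integrable_ramp (huv : u < v) (h : ν (Ici u) < ∞) : Integrable (ramp u v) ν := by
  refine (integrable_indicator_Ici h).mono' (continuous_ramp u v).aestronglyMeasurable ?_
  refine Eventually.of_forall fun x => ?_
  rw [Real.norm_of_nonneg (ramp_nonneg u v x)]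
  exact ramp_le_indicator huv x

theorem integral_ramp_le (huv : u < v) (h : ν (Ici u) < ∞) :
    ∫ x, ramp u v x ∂ν ≤ ν.real (Ici u) := by
  rw [← integral_indicator_one measurableSet_Ici]
  exact integral_mono (integrable_ramp huv h) (integrable_indicator_Ici h) (ramp_le_indicator huv)

theorem le_integral_ramp (huv : u < v) (h : ν (Ici u) < ∞) :
    ν.real (Ici v) ≤ ∫ x, ramp u v x ∂ν := by
  rw [← integral_indicator_one measurableSet_Ici]
  refine integral_mono (integrable_indicator_Ici ?_) (integrable_ramp huv h) (indicator_le_ramp huv)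
  exact (measure_mono (Ici_subset_Ici.2 huv.le)).trans_lt h

end

/-- Continuity of the tail of `γ` at `a`: the intervals `[a - r, a + r]` shrink to a null point and
have finite mass once `r` is small. -/
theorem exists_measureReal_Ici_close {γ : Measure ℝ} (hγ_noAtoms : ∀ x, γ {x} = 0)
    (hγ_finite : ∀ t : ℝ, 0 < t → γ (Ici t) < ∞) {a ε : ℝ} (ha : 0 < a) (hε : 0 < ε) :
    ∃ u v, 0 < u ∧ u < a ∧ a < v ∧ γ.real (Ici u) ≤ γ.real (Ici a) + ε ∧
      γ.real (Ici a) ≤ γ.real (Ici v) + ε := by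
  have hlim : Tendsto (fun r => γ (Icc (a - r) (a + r))) (𝓝[>] 0) (𝓝 0) := by
    have hInter : ⋂ r > (0 : ℝ), Icc (a - r) (a + r) = {a} := by
      ext x
      simp only [mem_iInter, mem_Icc, mem_singleton_iff]
      refine ⟨fun h => le_antisymm ?_ ?_, fun h r hr => by constructor <;> linarith⟩
      · exact le_of_forall_pos_le_add fun r hr => (h r hr).2
      · exact le_of_forall_pos_le_add fun r hr => by linarith [(h r hr).1]
    have := tendsto_measure_biInter_gt (μ := γ) (s := fun r : ℝ => Icc (a - r) (a + r)) (a := 0)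
      (fun _ _ => measurableSet_Icc.nullMeasurableSet)
      (fun r s _ hrs => Icc_subset_Icc (by linarith) (by linarith))
      ⟨a / 2, by positivity, ((measure_mono Icc_subset_Ici_self).trans_lt
        (hγ_finite _ (by linarith))).ne⟩
    rwa [hInter, hγ_noAtoms] at this
  have hev : ∀ᶠ r in 𝓝[>] (0 : ℝ), γ (Icc (a - r) (a + r)) < ENNReal.ofReal ε :=
    hlim.eventually_lt_const (by simpa using hε)
  obtain ⟨r, hr, hr0, hra⟩ := (hev.and (Ioo_mem_nhdsGT ha)).exists
  have hfin : γ (Icc (a - r) (a + r)) ≠ ∞ := (hr.trans ENNReal.ofReal_lt_top).ne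
  have hreal : γ.real (Icc (a - r) (a + r)) ≤ ε :=
    ENNReal.toReal_le_of_le_ofReal hε.le hr.le
  refine ⟨a - r, a + r, by linarith, by linarith, by linarith, ?_, ?_⟩
  · have hsub : Ici (a - r) ⊆ Ici a ∪ Icc (a - r) (a + r) := by
      intro x hx
      rcases le_total a x with h | h
      · exact Or.inl h
      · exact Or.inr ⟨hx, by linarith⟩
    have := (measureReal_mono hsub
      (measure_union_ne_top (hγ_finite a ha).ne hfin)).trans (measureReal_union_le _ _)
    linarith
  · have hsub : Ici a ⊆ Ici (a + r) ∪ Icc (a - r) (a + r) := by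
      intro x hx
      have hx : a ≤ x := hx
      rcases le_total (a + r) x with h | h
      · exact Or.inl h
      · exact Or.inr ⟨by linarith, h⟩
    have := (measureReal_mono hsub
      (measure_union_ne_top (hγ_finite _ (by linarith)).ne hfin)).trans (measureReal_union_le _ _)
    linarith

theorem rowSum_pos {c : (n : ℕ) → Fin n → ℝ} (hc_pos : ∀ n i, 0 < c n i) {n : ℕ} (i : Fin n) :
    0 < rowSum c n :=
  Finset.sum_pos (fun i _ => hc_pos n i) ⟨i, Finset.mem_univ i⟩

/-- Under `H₂` the tails converge uniformly over the row, after normalisation. -/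
theorem eventually_abs_tail_sub_le {ν : (n : ℕ) → Fin n → Measure ℝ}
    [∀ n i, IsProbabilityMeasure (ν n i)] {c : (n : ℕ) → Fin n → ℝ} (hc_pos : ∀ n i, 0 < c n i)
    {γ : Measure ℝ} (hγ_noAtoms : ∀ x, γ {x} = 0) (hγ_finite : ∀ t : ℝ, 0 < t → γ (Ici t) < ∞)
    (hγ_unif : ∀ t : ℝ, 0 < t → ∀ f ∈ testFunctions t,
      Tendsto (fun n => ⨆ i : Fin n,
        |rowSum c n / c n i * ∫ x, f x ∂(ν n i) - ∫ x, f x ∂γ|) atTop (𝓝 0))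
    {a ε : ℝ} (ha : 0 < a) (hε : 0 < ε) :
    ∀ᶠ n in atTop, ∀ i,
      |rowSum c n / c n i * (ν n i).real (Ici a) - γ.real (Ici a)| ≤ ε := by
  obtain ⟨u, v, hu, hua, hav, hγu, hγv⟩ :=
    exists_measureReal_Ici_close hγ_noAtoms hγ_finite ha (half_pos hε)
  -- The indicator of `Ici a` lies between the test functions `ramp a v` and `ramp u a`, whose
  -- `γ`-integrals are within `ε / 2` of `γ (Ici a)`; the remaining `ε / 2` pays for the convergence
  -- in `H₂`.
  have h1 := (hγ_unif u hu _ (ramp_mem_testFunctions hua)).eventually_lt_const (half_pos hε)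
  have h2 := (hγ_unif a ha _ (ramp_mem_testFunctions hav)).eventually_lt_const (half_pos hε)
  filter_upwards [h1, h2] with n h1 h2 i
  have h1' := abs_lt.1 ((le_ciSup (f := fun i : Fin n => |rowSum c n / c n i *
    ∫ x, ramp u a x ∂(ν n i) - ∫ x, ramp u a x ∂γ|) (Set.finite_range _).bddAbove i).trans_lt h1)
  have h2' := abs_lt.1 ((le_ciSup (f := fun i : Fin n => |rowSum c n / c n i *
    ∫ x, ramp a v x ∂(ν n i) - ∫ x, ramp a v x ∂γ|) (Set.finite_range _).bddAbove i).trans_lt h2)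
  have hd : 0 ≤ rowSum c n / c n i := (div_pos (rowSum_pos hc_pos i) (hc_pos n i)).le
  have e1 := mul_le_mul_of_nonneg_left
    (le_integral_ramp hua (measure_lt_top (ν n i) (Ici u))) hd
  have e2 := mul_le_mul_of_nonneg_left
    (integral_ramp_le hav (measure_lt_top (ν n i) (Ici a))) hd
  have e3 := integral_ramp_le hua (hγ_finite u hu)
  have e4 := le_integral_ramp hav (hγ_finite a ha)
  rw [abs_le]
  constructor <;> linarith

theorem measureReal_weightMeasure {c : (n : ℕ) → Fin n → ℝ} (hc_pos : ∀ n i, 0 < c n i) (n : ℕ)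
    (B : Set I) [DecidablePred (· ∈ B)] (hB : MeasurableSet B) :
    ((weightMeasure c n B : ℝ≥0) : ℝ) =
      ∑ i with gridPoint n i ∈ B, c n i / rowSum c n := by
  have hnn : ∀ i, 0 ≤ c n i / rowSum c n :=
    fun i => (div_pos (hc_pos n i) (rowSum_pos hc_pos i)).le
  have hdirac : ∀ i, ((diracProba (gridPoint n i)).toFiniteMeasure : Measure I) B =
      if gridPoint n i ∈ B then 1 else 0 := by
    intro i
    change Measure.dirac (gridPoint n i) B = _
    rw [Measure.dirac_apply' _ hB, indicator_apply]
    rfl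
  have : weightMeasure c n B = ∑ i with gridPoint n i ∈ B, (c n i / rowSum c n).toNNReal := by
    rw [weightMeasure, FiniteMeasure.coeFn_def]
    simp only [FiniteMeasure.toMeasure_sum, FiniteMeasure.toMeasure_smul]
    rw [Measure.finsetSum_apply, Finset.sum_filter, ENNReal.toNNReal_sum]
    · refine Finset.sum_congr rfl fun i _ => ?_
      rw [Measure.smul_apply, hdirac]
      by_cases h : gridPoint n i ∈ B <;> simp [h, ENNReal.smul_def]
    · intro i _
      rw [Measure.smul_apply, hdirac]
      by_cases h : gridPoint n i ∈ B <;> simp [h, ENNReal.smul_def]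
  rw [this, NNReal.coe_sum]
  exact Finset.sum_congr rfl fun i _ => Real.coe_toNNReal _ (hnn i)

/-- The portmanteau theorem for finite measures: the masses converge and the normalised measures
fall under the probability case. A zero limit cannot be normalised, but then the masses alone
suffice. -/
theorem _root_.MeasureTheory.FiniteMeasure.tendsto_apply_of_null_frontier {S : Type*}
    [MeasurableSpace S] [TopologicalSpace S] [OpensMeasurableSpace S] [HasOuterApproxClosed S]
    [Nonempty S] {ι : Type*} {l : Filter ι} {μs : ι → FiniteMeasure S} {μ : FiniteMeasure S}
    (hμ : Tendsto μs l (𝓝 μ)) {E : Set S} (hE : μ (frontier E) = 0) :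
    Tendsto (fun i => μs i E) l (𝓝 (μ E)) := by
  by_cases h0 : μ = 0
  · subst h0
    refine tendsto_of_tendsto_of_tendsto_of_le_of_le tendsto_const_nhds hμ.mass
      (fun _ => zero_le) (fun i => ?_)
    exact FiniteMeasure.apply_mono _ (subset_univ E)
  · have h := ProbabilityMeasure.tendsto_measure_of_null_frontier_of_tendsto
      (FiniteMeasure.tendsto_normalize_of_tendsto hμ h0) (E := E)
      (by rw [FiniteMeasure.normalize_eq_of_nonzero _ h0, hE, mul_zero])
    simp_rw [FiniteMeasure.self_eq_mass_mul_normalize _ E]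
    exact hμ.mass.mul h

section

variable {ν : (n : ℕ) → Fin n → Measure ℝ} {c : (n : ℕ) → Fin n → ℝ} {μ : FiniteMeasure I}
    {γ : Measure ℝ} {a : ℝ}

/-- Each tail is `c_{n,j}/d_n` times `γ (Ici a)` plus a uniformly small error. Since the weights sum
to at most one, the sum differs from `μ_n(B) γ (Ici a)` by a small amount, and `μ_n(B)` converges.
-/
theorem tendsto_sum_tail (hc_pos : ∀ n i, 0 < c n i)
    (hμ : Tendsto (weightMeasure c) atTop (𝓝 μ))
    (htail : ∀ ε : ℝ, 0 < ε → ∀ᶠ n in atTop, ∀ i,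
      |rowSum c n / c n i * (ν n i).real (Ici a) - γ.real (Ici a)| ≤ ε)
    (B : Set I) [DecidablePred (· ∈ B)] (hB : MeasurableSet B) (hfr : μ (frontier B) = 0) :
    Tendsto (fun n => ∑ i with gridPoint n i ∈ B, (ν n i).real (Ici a)) atTop
      (𝓝 (μ B * γ.real (Ici a))) := by
  have hw : Tendsto (fun n => ((weightMeasure c n B : ℝ≥0) : ℝ)) atTop (𝓝 (μ B)) :=
    NNReal.tendsto_coe.2 (FiniteMeasure.tendsto_apply_of_null_frontier hμ hfr)
  have hdiff : Tendsto (fun n => (∑ i with gridPoint n i ∈ B, (ν n i).real (Ici a)) -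
      weightMeasure c n B * γ.real (Ici a)) atTop (𝓝 0) := by
    rw [Metric.tendsto_nhds]
    intro ε hε
    filter_upwards [htail (ε / 2) (half_pos hε)] with n hn
    rw [dist_zero_right, measureReal_weightMeasure hc_pos n B hB, Finset.sum_mul,
      ← Finset.sum_sub_distrib, Real.norm_eq_abs]
    have hd : ∀ i, 0 < rowSum c n := fun i => rowSum_pos hc_pos i
    have hbound : ∀ i : Fin n, |(ν n i).real (Ici a) - c n i / rowSum c n * γ.real (Ici a)| ≤
        c n i / rowSum c n * (ε / 2) := by
      intro i
      have hci := hc_pos n i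
      have hdi := hd i
      have heq : (ν n i).real (Ici a) - c n i / rowSum c n * γ.real (Ici a) =
          c n i / rowSum c n *
            (rowSum c n / c n i * (ν n i).real (Ici a) - γ.real (Ici a)) := by
        field_simp
      rw [heq, abs_mul, abs_of_pos (div_pos hci hdi)]
      exact mul_le_mul_of_nonneg_left (hn i) (div_pos hci hdi).le
    calc |∑ i with gridPoint n i ∈ B,
          ((ν n i).real (Ici a) - c n i / rowSum c n * γ.real (Ici a))|
        ≤ ∑ i with gridPoint n i ∈ B,
          |(ν n i).real (Ici a) - c n i / rowSum c n * γ.real (Ici a)| :=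
          Finset.abs_sum_le_sum_abs _ _
      _ ≤ ∑ i with gridPoint n i ∈ B, c n i / rowSum c n * (ε / 2) :=
          Finset.sum_le_sum fun i _ => hbound i
      _ ≤ ∑ i, c n i / rowSum c n * (ε / 2) :=
          Finset.sum_le_sum_of_subset_of_nonneg (Finset.filter_subset _ _) fun i _ _ =>
            mul_nonneg (div_pos (hc_pos n i) (hd i)).le (half_pos hε).le
      _ = rowSum c n / rowSum c n * (ε / 2) := by
          rw [← Finset.sum_mul, ← Finset.sum_div]; rfl
      -- An inequality, since the empty row has `rowSum c 0 = 0` and `0 / 0 = 0`.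
      _ ≤ 1 * (ε / 2) := by gcongr; exact div_self_le_one _
      _ < ε := by linarith
  simpa using hdiff.add (hw.mul_const (γ.real (Ici a)))

theorem eventually_tail_le (hc_pos : ∀ n i, 0 < c n i)
    (hc_max : Tendsto (fun n => (⨆ i, c n i) / rowSum c n) atTop (𝓝 0))
    (htail : ∀ ε : ℝ, 0 < ε → ∀ᶠ n in atTop, ∀ i,
      |rowSum c n / c n i * (ν n i).real (Ici a) - γ.real (Ici a)| ≤ ε)
    {δ : ℝ} (hδ : 0 < δ) : ∀ᶠ n in atTop, ∀ i, (ν n i).real (Ici a) ≤ δ := by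
  have hΓ : 0 < γ.real (Ici a) + 1 := by positivity
  filter_upwards [htail 1 one_pos, hc_max.eventually_lt_const (div_pos hδ hΓ)] with n hn hmax i
  have hci := hc_pos n i
  have hdi := rowSum_pos hc_pos i
  have h1 : c n i / rowSum c n ≤ δ / (γ.real (Ici a) + 1) := by
    refine le_trans ?_ hmax.le
    gcongr
    exact le_ciSup (Set.finite_range (c n)).bddAbove i
  have h2 : rowSum c n / c n i * (ν n i).real (Ici a) ≤ γ.real (Ici a) + 1 := by
    linarith [(abs_le.1 (hn i)).2]
  calc (ν n i).real (Ici a)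
      = c n i / rowSum c n * (rowSum c n / c n i * (ν n i).real (Ici a)) := by field_simp
    _ ≤ δ / (γ.real (Ici a) + 1) * (γ.real (Ici a) + 1) := by gcongr
    _ = δ := by field_simp

end

/-- Products of factors close to `1` converge to the exponential of the limit of the sums. -/
theorem tendsto_prod_one_sub {κ : ℕ → Type*} {s : (n : ℕ) → Finset (κ n)} {p : (n : ℕ) → κ n → ℝ}
    (hp : ∀ n i, 0 ≤ p n i) {l : ℝ} (hsum : Tendsto (fun n => ∑ i ∈ s n, p n i) atTop (𝓝 l))
    (hmax : ∀ δ : ℝ, 0 < δ → ∀ᶠ n in atTop, ∀ i, p n i ≤ δ) :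
    Tendsto (fun n => ∏ i ∈ s n, (1 - p n i)) atTop (𝓝 (Real.exp (-l))) := by
  have hupper : Tendsto (fun n => Real.exp (-∑ i ∈ s n, p n i)) atTop (𝓝 (Real.exp (-l))) :=
    (Real.continuous_exp.tendsto _).comp hsum.neg
  rw [tendsto_order]
  constructor
  · intro b hb
    -- Lower bound: `1 - p ≥ exp (-p / (1 - p)) ≥ exp (-p / (1 - δ))` for `0 ≤ p ≤ δ < 1`, the first
    -- inequality being `1 + x ≤ exp x` at `x = p / (1 - p)`. Here `δ` is so small that `exp (-l /
    -- (1 - δ))` still exceeds `b`.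
    have hlow : Tendsto (fun δ : ℝ => Real.exp (-(l * (1 / (1 - δ))))) (𝓝[>] 0)
        (𝓝 (Real.exp (-l))) := by
      have : ContinuousAt (fun δ : ℝ => Real.exp (-(l * (1 / (1 - δ))))) 0 := by
        fun_prop (disch := norm_num)
      simpa using this.tendsto.mono_left nhdsWithin_le_nhds
    obtain ⟨δ, hδb, hδ0, hδ1⟩ :=
      ((hlow.eventually_const_lt hb).and (Ioo_mem_nhdsGT (zero_lt_one' ℝ))).exists
    have hlow2 : Tendsto (fun n => Real.exp (-((∑ i ∈ s n, p n i) * (1 / (1 - δ))))) atTop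
        (𝓝 (Real.exp (-(l * (1 / (1 - δ)))))) :=
      (Real.continuous_exp.tendsto _).comp (hsum.mul_const _).neg
    filter_upwards [hlow2.eventually_const_lt hδb, hmax δ hδ0] with n hn hpn
    refine hn.trans_le ?_
    rw [Finset.sum_mul, ← Finset.sum_neg_distrib, Real.exp_sum]
    refine Finset.prod_le_prod (fun i _ => (Real.exp_pos _).le) fun i _ => ?_
    have h1 : 0 < 1 - p n i := by linarith [hpn i]
    calc Real.exp (-(p n i * (1 / (1 - δ)))) ≤ Real.exp (-(p n i * (1 / (1 - p n i)))) := by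
          have := hp n i
          have := hpn i
          gcongr
      _ = (Real.exp (p n i * (1 / (1 - p n i))))⁻¹ := Real.exp_neg _
      _ ≤ (1 / (1 - p n i))⁻¹ := by
          gcongr
          have := Real.add_one_le_exp (p n i * (1 / (1 - p n i)))
          have heq : p n i * (1 / (1 - p n i)) + 1 = 1 / (1 - p n i) := by field_simp; ring
          linarith
      _ = 1 - p n i := by simp
  · intro b hb
    -- The bound `p ≤ 1` keeps the factors nonnegative, as multiplying the inequalities `1 - p ≤ exp
    -- (-p)` requires.
    filter_upwards [hupper.eventually_lt_const hb, hmax 1 one_pos] with n hn hpn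
    refine lt_of_le_of_lt ?_ hn
    rw [← Finset.sum_neg_distrib, Real.exp_sum]
    exact Finset.prod_le_prod (fun i _ => by linarith [hpn i]) fun i _ => Real.one_sub_le_exp_neg _

/-! ### Convergence of laws on the line and independence -/

/-- Half-open intervals with endpoints in `D` form a π-system containing arbitrarily small
neighbourhoods of every point, and their measures are differences of values on `Iio`. A dense `D` is
enough, so that exceptional levels can be avoided. -/
theorem tendsto_of_tendsto_Iio {ι : Type*} {l : Filter ι} [l.IsCountablyGenerated]
    {ν : ι → ProbabilityMeasure ℝ} {ν' : ProbabilityMeasure ℝ} {D : Set ℝ} (hD : Dense D)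
    (h : ∀ a ∈ D, Tendsto (fun i => ν i (Iio a)) l (𝓝 (ν' (Iio a)))) : Tendsto ν l (𝓝 ν') := by
  have hIco : ∀ (ρ : ProbabilityMeasure ℝ) (a b : ℝ), ρ (Ico a b) = ρ (Iio b) - ρ (Iio a) := by
    intro ρ a b
    rcases le_total a b with hab | hab
    · have hunion : Iio b = Iio a ∪ Ico a b := (Iio_union_Ico_eq_Iio hab).symm
      have hdisj : Disjoint (Iio a) (Ico a b) := by
        rw [Set.disjoint_left]
        exact fun x hx hx' => absurd hx'.1 (not_le.2 hx)
      have : ρ (Iio b) = ρ (Iio a) + ρ (Ico a b) := by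
        rw [← ENNReal.coe_inj, ENNReal.coe_add]
        simp only [ProbabilityMeasure.ennreal_coeFn_eq_coeFn_toMeasure]
        rw [hunion, measure_union hdisj measurableSet_Ico]
      rw [this, add_tsub_cancel_left]
    · rw [Ico_eq_empty (not_lt.2 hab), tsub_eq_zero_of_le (ρ.apply_mono (Iio_subset_Iio hab))]
      simp
  refine IsPiSystem.tendsto_probabilityMeasure_of_tendsto_of_mem
    (S := {s | ∃ a ∈ D, ∃ b ∈ D, s = Ico a b}) ?_ ?_ ?_ ?_
  · rintro _ ⟨a, ha, b, hb, rfl⟩ _ ⟨a', ha', b', hb', rfl⟩ _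
    refine ⟨a ⊔ a', ?_, b ⊓ b', ?_, Ico_inter_Ico⟩
    · rcases max_choice a a' with h | h <;> rw [h] <;> assumption
    · rcases min_choice b b' with h | h <;> rw [h] <;> assumption
  · rintro _ ⟨a, _, b, _, rfl⟩
    exact measurableSet_Ico
  · intro u hu x hx
    obtain ⟨l, r, ⟨hl, hr⟩, hlr⟩ := mem_nhds_iff_exists_Ioo_subset.1 (hu.mem_nhds hx)
    obtain ⟨a, ha, hla, hax⟩ := hD.exists_between hl
    obtain ⟨b, hb, hxb, hbr⟩ := hD.exists_between hr
    refine ⟨Ico a b, ⟨a, ha, b, hb, rfl⟩, Ico_mem_nhds hax hxb, ?_⟩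
    exact fun y hy => hlr ⟨hla.trans_le hy.1, hy.2.trans hbr⟩
  · rintro _ ⟨a, ha, b, hb, rfl⟩
    simp_rw [hIco]
    exact (h b hb).sub (h a ha)

/-- The half-lines `Iio a` form a generating π-system; for nonnegative variables a level `a ≤ 0`
gives an empty event and both sides vanish. -/
theorem iIndepFun_of_measure_lt {S ι : Type*} [MeasurableSpace S] {ρ : Measure S}
    {y : ι → S → ℝ} (hy : ∀ i, Measurable (y i)) (hnn : ∀ i s, 0 ≤ y i s)
    (h : ∀ (T : Finset ι) (a : ι → ℝ), (∀ i ∈ T, 0 < a i) →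
      ρ (⋂ i ∈ T, {s | y i s < a i}) = ∏ i ∈ T, ρ {s | y i s < a i}) :
    iIndepFun y ρ := by
  refine iIndepSets.iIndep (fun i => (hy i).comap_le)
    (fun i => {s | ∃ a, y i ⁻¹' Iio a = s}) (fun i => ?_) (fun i => ?_) ?_
  · rintro _ ⟨a, rfl⟩ _ ⟨b, rfl⟩ _
    exact ⟨a ⊓ b, by rw [← Iio_inter_Iio, preimage_inter]⟩
  · rw [BorelSpace.measurable_eq (α := ℝ), borel_eq_generateFrom_Iio,
      MeasurableSpace.comap_generateFrom]
    congr 1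
    ext s
    simp
  · rw [iIndepSets_iff]
    intro T f hf
    choose! a ha using hf
    have hf' : ∀ i ∈ T, f i = {s | y i s < a i} := fun i hi => (ha i hi).symm
    by_cases hpos : ∀ i ∈ T, 0 < a i
    · rw [Set.iInter₂_congr hf', h T a hpos]
      exact Finset.prod_congr rfl fun i hi => by rw [hf' i hi]
    · push Not at hpos
      obtain ⟨i, hi, hai⟩ := hpos
      have hempty : f i = ∅ := by
        rw [hf' i hi]
        exact Set.eq_empty_of_forall_notMem fun s hs => absurd (hnn i s)
          (not_le.2 (lt_of_lt_of_le hs hai))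
      rw [Finset.prod_eq_zero hi (by rw [hempty, measure_empty])]
      exact measure_mono_null (Set.biInter_subset_of_mem hi) (by rw [hempty, measure_empty])

/-- By independence the joint laws are products of the marginals, and the product measure depends
continuously on its factors. -/
theorem tendstoInDistribution_pi {ι : Type*} {l : Filter ι} {κ : Type*} [Fintype κ]
    {S : ι → Type*} {S' : Type*} {mS : ∀ i, MeasurableSpace (S i)} [MeasurableSpace S']
    {ρ : (i : ι) → Measure (S i)} [∀ i, IsProbabilityMeasure (ρ i)] {ρ' : Measure S'}
    [IsProbabilityMeasure ρ'] {y : (i : ι) → κ → S i → ℝ} {z : κ → S' → ℝ}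
    (hy : ∀ i, iIndepFun (y i) (ρ i)) (hz : iIndepFun z ρ')
    (h : ∀ k, TendstoInDistribution (fun i => y i k) l (z k) ρ ρ') :
    TendstoInDistribution (fun i s k => y i k s) l (fun s k => z k s) ρ ρ' where
  forall_aemeasurable i := aemeasurable_pi_lambda _ fun k => (h k).forall_aemeasurable i
  aemeasurable_limit := aemeasurable_pi_lambda _ fun k => (h k).aemeasurable_limit
  tendsto := by
    have hlim := (ProbabilityMeasure.continuous_pi (ι := κ) (α := fun _ => ℝ)).tendsto
      (fun k => ⟨ρ'.map (z k), Measure.isProbabilityMeasure_map (h k).aemeasurable_limit⟩)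
    have hcomp := hlim.comp (tendsto_pi_nhds.2 fun k => (h k).tendsto)
    refine (hcomp.mono_right (le_of_eq (congrArg 𝓝 (Subtype.ext ?_)))).congr
      fun i => Subtype.ext ?_
    · exact ((iIndepFun_iff_map_fun_eq_pi_map fun k => (h k).aemeasurable_limit).1 hz).symm
    · exact ((iIndepFun_iff_map_fun_eq_pi_map fun k => (h k).forall_aemeasurable i).1 (hy i)).symm

/-! ### Maxima of a Poisson process -/

section Poisson

variable {Ω' : Type*} [MeasurableSpace Ω'] {Q : Measure Ω'} {ζ : Ω' → Config}
  {μ : FiniteMeasure I} {γ : Measure ℝ} {B : Set I} {a : ℝ}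

/-- The mass of `γ` may blow up only at `0`; σ-finiteness makes the product with `μ` computable on
rectangles. -/
theorem sigmaFinite_of_measure_Ici_lt_top (hγ_pos : γ (Iic 0) = 0)
    (hγ_finite : ∀ t : ℝ, 0 < t → γ (Ici t) < ∞) : SigmaFinite γ := by
  refine ⟨⟨⟨fun n => Iic 0 ∪ Ici (1 / ((n : ℝ) + 1)), fun _ => trivial, fun n => ?_, ?_⟩⟩⟩
  · refine (measure_union_le _ _).trans_lt ?_
    rw [hγ_pos, zero_add]
    exact hγ_finite _ (by positivity)
  · refine Set.eq_univ_of_forall fun x => mem_iUnion.2 ?_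
    rcases le_or_gt x 0 with hx | hx
    · exact ⟨0, Or.inl hx⟩
    · obtain ⟨n, hn⟩ := exists_nat_one_div_lt hx
      exact ⟨n, Or.inr hn.le⟩

theorem isBoundedBorel_prod_Ici (hB : MeasurableSet B) (ha : 0 < a) :
    IsBoundedBorel (B ×ˢ Ici a) :=
  ⟨hB.prod measurableSet_Ici, a, ha, fun _ hp => hp.2⟩

theorem toNNReal_prod_Ici [SFinite γ] :
    ((((μ : Measure I).prod γ) (B ×ˢ Ici a)).toNNReal : ℝ) = μ B * γ.real (Ici a) := by
  rw [Measure.prod_prod, ENNReal.toNNReal_mul, NNReal.coe_mul]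
  rfl

theorem measure_count_eq (hζ : IsPoissonProcess Q ζ ((μ : Measure I).prod γ))
    {C : Set (I × ℝ)} (hC : IsBoundedBorel C) (s : Set ℕ) :
    Q {ω | (ζ ω).count C ∈ s} = poissonMeasure (((μ : Measure I).prod γ) C).toNNReal s := by
  rw [← hζ.law_count _ hC, Measure.map_apply (hζ.measurable_count _ hC) MeasurableSet.of_discrete]
  rfl

omit [MeasurableSpace Ω'] in
theorem setOf_maxOn_lt (ha : 0 < a) :
    {ω | (ζ ω).maxOn B < a} = (fun ω => (ζ ω).count (B ×ˢ Ici a)) ⁻¹' {0} := by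
  ext ω
  exact Config.maxOn_lt_iff_count_eq_zero ha

theorem measurable_maxOn (hζ : IsPoissonProcess Q ζ ((μ : Measure I).prod γ))
    (hB : MeasurableSet B) : Measurable fun ω => (ζ ω).maxOn B := by
  refine measurable_of_Iio fun a => ?_
  rcases le_or_gt a 0 with ha | ha
  · have : (fun ω => (ζ ω).maxOn B) ⁻¹' Iio a = ∅ :=
      Set.eq_empty_of_forall_notMem fun ω hω =>
        absurd ((ζ ω).maxOn_nonneg B) (not_le.2 (lt_of_lt_of_le hω ha))
    rw [this]
    exact MeasurableSet.empty
  · change MeasurableSet {ω | (ζ ω).maxOn B < a}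
    rw [setOf_maxOn_lt ha]
    exact hζ.measurable_count _ (isBoundedBorel_prod_Ici hB ha) (measurableSet_singleton 0)

theorem measureReal_maxOn_lt [SFinite γ] (hζ : IsPoissonProcess Q ζ ((μ : Measure I).prod γ))
    (hB : MeasurableSet B) (ha : 0 < a) :
    Q.real {ω | (ζ ω).maxOn B < a} = Real.exp (-(μ B * γ.real (Ici a))) := by
  rw [setOf_maxOn_lt ha, ← toNNReal_prod_Ici (μ := μ) (γ := γ)]
  have := measure_count_eq hζ (isBoundedBorel_prod_Ici hB ha) {0}
  rw [measureReal_def]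
  change (Q {ω | (ζ ω).count (B ×ˢ Ici a) ∈ ({0} : Set ℕ)}).toReal = _
  rw [this, ← measureReal_def, poissonMeasure_real_singleton]
  simp

theorem iIndepFun_maxOn {k : ℕ} {B : Fin k → Set I}
    (hζ : IsPoissonProcess Q ζ ((μ : Measure I).prod γ)) (hB : ∀ i, MeasurableSet (B i))
    (hdisj : Pairwise fun i j => Disjoint (B i) (B j)) :
    iIndepFun (fun i ω => (ζ ω).maxOn (B i)) Q := by
  classical
  refine iIndepFun_of_measure_lt (fun i => measurable_maxOn hζ (hB i))
    (fun i ω => (ζ ω).maxOn_nonneg _) fun T a ha => ?_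
  -- Levels outside `T` are irrelevant; the value `1` merely keeps all `k` sets bounded away from
  -- height `0`.
  have hpos : ∀ i, 0 < if i ∈ T then a i else 1 := by
    intro i
    split_ifs with h
    · exact ha i h
    · exact one_pos
  have hind := hζ.indep_count k (fun i => B i ×ˢ Ici (if i ∈ T then a i else 1))
    (fun i => isBoundedBorel_prod_Ici (hB i) (hpos i)) fun i j hij =>
      Disjoint.set_prod_left (hdisj hij) _ _
  have heq : ∀ i ∈ T, {ω | (ζ ω).maxOn (B i) < a i} =
      (fun ω => (ζ ω).count (B i ×ˢ Ici (if i ∈ T then a i else 1))) ⁻¹' {0} := by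
    intro i hi
    rw [← setOf_maxOn_lt (hpos i)]
    simp only [hi, if_true]
  rw [Set.iInter₂_congr heq, Finset.prod_congr rfl fun i hi => by rw [heq i hi]]
  exact hind.measure_inter_preimage_eq_mul T fun i _ => measurableSet_singleton 0

/-- From `exp (-r) ≥ 1 - r`: `1 - exp (-r) (1 + r) ≤ 1 - (1 - r) (1 + r) = r ^ 2`. -/
theorem poissonMeasure_real_two_le (r : ℝ≥0) : (poissonMeasure r).real {n | 2 ≤ n} ≤ (r : ℝ) ^ 2 := by
  have hcompl : {n : ℕ | 2 ≤ n} = ({0, 1} : Set ℕ)ᶜ := by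
    ext n
    simp only [mem_ofPred_eq, mem_compl_iff, mem_insert_iff, mem_singleton_iff]
    omega
  have hpair : (poissonMeasure r).real {0, 1} = Real.exp (-r) * (1 + r) := by
    rw [show ({0, 1} : Set ℕ) = {0} ∪ {1} from rfl,
      measureReal_union (by simp) (measurableSet_singleton 1),
      poissonMeasure_real_singleton, poissonMeasure_real_singleton]
    simp
    ring
  rw [hcompl, probReal_compl_eq_one_sub MeasurableSet.of_discrete, hpair]
  have h1 := Real.add_one_le_exp (-(r : ℝ))
  nlinarith [r.coe_nonneg]

theorem poissonMeasure_real_one_le (r : ℝ≥0) : (poissonMeasure r).real {n | 1 ≤ n} ≤ r := by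
  have hcompl : {n : ℕ | 1 ≤ n} = ({0} : Set ℕ)ᶜ := by
    ext n
    simp only [mem_ofPred_eq, mem_compl_iff, mem_singleton_iff]
    omega
  rw [hcompl, probReal_compl_eq_one_sub MeasurableSet.of_discrete, poissonMeasure_real_singleton]
  have h1 := Real.add_one_le_exp (-(r : ℝ))
  simp
  linarith

theorem measureReal_one_le_count_le (hζ : IsPoissonProcess Q ζ ((μ : Measure I).prod γ))
    {C : Set (I × ℝ)} (hC : IsBoundedBorel C) :
    Q.real {ω | 1 ≤ (ζ ω).count C} ≤ ((μ : Measure I).prod γ).real C := by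
  refine le_trans (le_of_eq ?_) (poissonMeasure_real_one_le _)
  rw [measureReal_def, measureReal_def, ← measure_count_eq hζ hC]
  rfl

theorem measureReal_two_le_count_le (hζ : IsPoissonProcess Q ζ ((μ : Measure I).prod γ))
    {C : Set (I × ℝ)} (hC : IsBoundedBorel C) :
    Q.real {ω | 2 ≤ (ζ ω).count C} ≤ ((μ : Measure I).prod γ).real C ^ 2 := by
  refine le_trans (le_of_eq ?_) (poissonMeasure_real_two_le _)
  rw [measureReal_def, measureReal_def, ← measure_count_eq hζ hC]
  rfl

end Poisson

/-! ### Maxima of the array -/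

/-- A row-wise independent array whose exceedances over a level `a` are individually negligible and
have total mass asymptotic to `μ B * Γ a` over the times in a `μ`-continuity set `B`. -/
structure IsNullArray {Ω : Type*} [MeasurableSpace Ω] (P : Measure Ω)
    (X : (n : ℕ) → Fin n → Ω → ℝ) (μ : FiniteMeasure I) (Γ : ℝ → ℝ) : Prop where
  measurable : ∀ n i, Measurable (X n i)
  indep : ∀ n, iIndepFun (X n) P
  nonneg : ∀ n i ω, 0 ≤ X n i ω
  tendsto_sum : ∀ a, 0 < a → ∀ (B : Set I) [DecidablePred (· ∈ B)], MeasurableSet B →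
    μ (frontier B) = 0 →
    Tendsto (fun n => ∑ i with gridPoint n i ∈ B, P.real {ω | a ≤ X n i ω}) atTop (𝓝 (μ B * Γ a))
  eventually_le : ∀ a, 0 < a → ∀ δ : ℝ, 0 < δ → ∀ᶠ n in atTop, ∀ i, P.real {ω | a ≤ X n i ω} ≤ δ

section Array

variable {Ω : Type*} [MeasurableSpace Ω] {P : Measure Ω} [IsProbabilityMeasure P]
  {X : (n : ℕ) → Fin n → Ω → ℝ} {μ : FiniteMeasure I} {Γ : ℝ → ℝ} {B : Set I} {a : ℝ}

/-- After this lemma, `H₂` and the negligibility of the individual weights are used only through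
`IsNullArray`. -/
theorem isNullArray {γ : Measure ℝ} {c : (n : ℕ) → Fin n → ℝ}
    (hX_meas : ∀ n i, Measurable (X n i)) (hX_indep : ∀ n, iIndepFun (X n) P)
    (hX_nonneg : ∀ n i ω, 0 ≤ X n i ω) (hc_pos : ∀ n i, 0 < c n i)
    (hc_max : Tendsto (fun n => (⨆ i, c n i) / rowSum c n) atTop (𝓝 0))
    (hμ : Tendsto (weightMeasure c) atTop (𝓝 μ))
    (hγ_noAtoms : ∀ x, γ {x} = 0) (hγ_finite : ∀ t : ℝ, 0 < t → γ (Ici t) < ∞)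
    (hγ_unif : ∀ t : ℝ, 0 < t → ∀ f ∈ testFunctions t,
      Tendsto (fun n => ⨆ i : Fin n,
        |rowSum c n / c n i * ∫ x, f x ∂(P.map (X n i)) - ∫ x, f x ∂γ|) atTop (𝓝 0)) :
    IsNullArray P X μ (fun a => γ.real (Ici a)) := by
  have hprob : ∀ n i, IsProbabilityMeasure (P.map (X n i)) :=
    fun n i => Measure.isProbabilityMeasure_map (hX_meas n i).aemeasurable
  have htail : ∀ a, 0 < a → ∀ ε : ℝ, 0 < ε → ∀ᶠ n in atTop, ∀ i,
      |rowSum c n / c n i * (P.map (X n i)).real (Ici a) - γ.real (Ici a)| ≤ ε :=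
    fun a ha ε hε => eventually_abs_tail_sub_le hc_pos hγ_noAtoms hγ_finite hγ_unif ha hε
  have hreal : ∀ a n i, P.real {ω | a ≤ X n i ω} = (P.map (X n i)).real (Ici a) :=
    fun a n i => (map_measureReal_apply (hX_meas n i) measurableSet_Ici).symm
  refine ⟨hX_meas, hX_indep, hX_nonneg, fun a ha B _ hB hfr => ?_, fun a ha δ hδ => ?_⟩
  · simp_rw [hreal]
    exact tendsto_sum_tail hc_pos hμ (htail a ha) B hB hfr
  · simp_rw [hreal]
    exact eventually_tail_le hc_pos hc_max (htail a ha) hδ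

-- One condition per index, trivial when the grid point is outside `B`; in this form row
-- independence applies directly.
omit [MeasurableSpace Ω] in
theorem setOf_maxOn_empiricalConfig_lt {n : ℕ} (ha : 0 < a) :
    {ω | (empiricalConfig fun i => X n i ω).maxOn B < a} =
      ⋂ j ∈ Finset.univ, X n j ⁻¹' {x | gridPoint n j ∈ B → x < a} := by
  ext ω
  simp only [mem_ofPred_eq, maxOn_empiricalConfig_lt_iff ha, Finset.mem_univ, iInter_true,
    mem_iInter, mem_preimage]

theorem measurableSet_imp_lt (p : Prop) (a : ℝ) : MeasurableSet {x : ℝ | p → x < a} := by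
  by_cases hp : p
  · have : {x : ℝ | p → x < a} = Iio a := by
      ext x
      simp [hp]
    rw [this]
    exact measurableSet_Iio
  · simp [hp]

theorem measurable_maxOn_empiricalConfig {n : ℕ} (B : Set I) :
    Measurable fun x : Fin n → ℝ => (empiricalConfig x).maxOn B := by
  refine Continuous.measurable (LipschitzWith.continuous (K := 1) (LipschitzWith.of_dist_le_mul
    fun x y => ?_))
  rw [NNReal.coe_one, one_mul, Real.dist_eq]
  exact abs_maxOn_empiricalConfig_sub_le (fun i => dist_le_pi_dist x y i) dist_nonneg B

theorem measurable_row (hX : ∀ n i, Measurable (X n i)) (n : ℕ) :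
    Measurable fun ω i => X n i ω := measurable_pi_lambda _ (hX n)

theorem iIndepFun_maxOn_empiricalConfig (hX : ∀ n i, Measurable (X n i))
    (hind : ∀ n, iIndepFun (X n) P) (n : ℕ) {κ : Type*} {B : κ → Set I}
    (hdisj : Pairwise fun i j => Disjoint (B i) (B j)) :
    iIndepFun (fun k ω => (empiricalConfig fun i => X n i ω).maxOn (B k)) P := by
  classical
  refine iIndepFun_of_measure_lt
    (fun k => (measurable_maxOn_empiricalConfig (B k)).comp (measurable_row hX n))
    (fun k ω => Config.maxOn_nonneg _ _) fun T a ha => ?_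
  have hinter : ⋂ k ∈ T, {ω | (empiricalConfig fun i => X n i ω).maxOn (B k) < a k} =
      ⋂ j ∈ Finset.univ, X n j ⁻¹' (⋂ k ∈ T, {x | gridPoint n j ∈ B k → x < a k}) := by
    rw [Set.iInter₂_congr fun k hk => setOf_maxOn_empiricalConfig_lt (ha k hk)]
    ext ω
    simp only [Finset.mem_univ, iInter_true, mem_iInter, mem_preimage]
    exact ⟨fun h j k hk => h k hk j, fun h k hk j => h j k hk⟩
  rw [hinter, (hind n).measure_inter_preimage_eq_mul _ fun j _ =>
    Finset.measurableSet_biInter _ fun k _ => measurableSet_imp_lt _ _]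
  have hsingle : ∀ k ∈ T, P {ω | (empiricalConfig fun i => X n i ω).maxOn (B k) < a k} =
      ∏ j, P (X n j ⁻¹' {x | gridPoint n j ∈ B k → x < a k}) := by
    intro k hk
    rw [setOf_maxOn_empiricalConfig_lt (ha k hk),
      (hind n).measure_inter_preimage_eq_mul _ fun j _ => measurableSet_imp_lt _ _]
  -- With the product over the row outermost, the claim is an identity for each `j`: by disjointness
  -- at most one `k` constrains `X n j`, and all other factors are `1`.
  rw [Finset.prod_congr rfl hsingle, Finset.prod_comm]
  refine Finset.prod_congr rfl fun j _ => ?_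
  by_cases h : ∃ k ∈ T, gridPoint n j ∈ B k
  · obtain ⟨k, hk, hjk⟩ := h
    have huniq : ∀ k' ∈ T, k' ≠ k → {x | gridPoint n j ∈ B k' → x < a k'} = univ :=
      fun k' _ hk' => eq_univ_of_forall fun x hx =>
        absurd hjk (Set.disjoint_left.1 (hdisj hk') hx)
    rw [Finset.prod_eq_single_of_mem k hk fun k' hk'T hk' => by
      rw [huniq k' hk'T hk', preimage_univ, measure_univ]]
    congr 2
    refine Set.Subset.antisymm (Set.biInter_subset_of_mem hk) ?_
    refine Set.subset_iInter₂ fun k' hk' => ?_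
    by_cases hkk : k' = k
    · rw [hkk]
    · rw [huniq k' hk' hkk]
      exact subset_univ _
  · push Not at h
    have huniv : ∀ k ∈ T, {x | gridPoint n j ∈ B k → x < a k} = univ :=
      fun k hk => eq_univ_of_forall fun x hx => absurd hx (h k hk)
    rw [Set.iInter₂_congr huniv, Finset.prod_eq_one fun k hk => by
      rw [huniv k hk, preimage_univ, measure_univ]]
    simp

theorem IsNullArray.tendsto_measureReal_maxOn_lt (hX : IsNullArray P X μ Γ)
    (hB : MeasurableSet B) (hfr : μ (frontier B) = 0) (ha : 0 < a) :
    Tendsto (fun n => P.real {ω | (empiricalConfig fun i => X n i ω).maxOn B < a}) atTop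
      (𝓝 (Real.exp (-(μ B * Γ a)))) := by
  classical
  refine (tendsto_prod_one_sub (fun n i => measureReal_nonneg) (hX.tendsto_sum a ha B hB hfr)
    (hX.eventually_le a ha)).congr fun n => ?_
  rw [setOf_maxOn_empiricalConfig_lt ha, measureReal_def,
    (hX.indep n).measure_inter_preimage_eq_mul _ fun j _ => measurableSet_imp_lt _ _,
    ENNReal.toReal_prod, Finset.prod_filter]
  refine Finset.prod_congr rfl fun j _ => ?_
  split_ifs with hj
  · rw [← probReal_compl_eq_one_sub (measurableSet_le measurable_const (hX.measurable n j)),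
      measureReal_def]
    congr 2
    ext ω
    simp [hj]
  · simp [hj]

end Array

section Joint

variable {Ω Ω' : Type*} [MeasurableSpace Ω] [MeasurableSpace Ω']
  {P : Measure Ω} [IsProbabilityMeasure P] {Q : Measure Ω'} [IsProbabilityMeasure Q]
  {X : (n : ℕ) → Fin n → Ω → ℝ} {μ : FiniteMeasure I} {γ : Measure ℝ} [SFinite γ]
  {ζ : Ω' → Config}

/-- Both sides vanish on `Iio a` for `a ≤ 0`, so an atom of the limit at `0`, present when `γ` is
finite, does no harm. -/
theorem tendstoInDistribution_maxOn (hX : IsNullArray P X μ (fun a => γ.real (Ici a)))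
    (hζ : IsPoissonProcess Q ζ ((μ : Measure I).prod γ)) {B : Set I} (hB : MeasurableSet B)
    (hfr : μ (frontier B) = 0) :
    TendstoInDistribution (fun n ω => (empiricalConfig fun i => X n i ω).maxOn B) atTop
      (fun ω => (ζ ω).maxOn B) (fun _ => P) Q where
  forall_aemeasurable n :=
    ((measurable_maxOn_empiricalConfig B).comp (measurable_row hX.measurable n)).aemeasurable
  aemeasurable_limit := (measurable_maxOn hζ hB).aemeasurable
  tendsto := by
    refine tendsto_of_tendsto_Iio dense_univ fun a _ => ?_
    rw [← NNReal.tendsto_coe]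
    have h1 : ∀ n, (P.map fun ω => (empiricalConfig fun i => X n i ω).maxOn B).real (Iio a) =
        P.real {ω | (empiricalConfig fun i => X n i ω).maxOn B < a} := fun n =>
      map_measureReal_apply ((measurable_maxOn_empiricalConfig B).comp
        (measurable_row hX.measurable n)) measurableSet_Iio
    have h2 : (Q.map fun ω => (ζ ω).maxOn B).real (Iio a) = Q.real {ω | (ζ ω).maxOn B < a} :=
      map_measureReal_apply (measurable_maxOn hζ hB) measurableSet_Iio
    change Tendsto (fun n => (P.map fun ω =>
      (empiricalConfig fun i => X n i ω).maxOn B).real (Iio a)) atTop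
        (𝓝 ((Q.map fun ω => (ζ ω).maxOn B).real (Iio a)))
    rw [h2]
    simp_rw [h1]
    rcases le_or_gt a 0 with ha | ha
    · have e1 : ∀ n, {ω | (empiricalConfig fun i => X n i ω).maxOn B < a} = ∅ := fun n =>
        Set.eq_empty_of_forall_notMem fun s hs =>
          absurd (Config.maxOn_nonneg _ B) (not_le.2 (lt_of_lt_of_le hs ha))
      have e2 : {ω | (ζ ω).maxOn B < a} = ∅ :=
        Set.eq_empty_of_forall_notMem fun s hs =>
          absurd (Config.maxOn_nonneg _ B) (not_le.2 (lt_of_lt_of_le hs ha))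
      simp [e1, e2]
    · rw [measureReal_maxOn_lt hζ hB ha]
      exact hX.tendsto_measureReal_maxOn_lt hB hfr ha

theorem tendstoInDistribution_maxOn_pi (hX : IsNullArray P X μ (fun a => γ.real (Ici a)))
    (hζ : IsPoissonProcess Q ζ ((μ : Measure I).prod γ)) {k : ℕ} {B : Fin k → Set I}
    (hB : ∀ i, MeasurableSet (B i)) (hdisj : Pairwise fun i j => Disjoint (B i) (B j))
    (hfr : ∀ i, μ (frontier (B i)) = 0) :
    TendstoInDistribution
      (fun n ω (j : Fin k) => (empiricalConfig fun i => X n i ω).maxOn (B j)) atTop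
      (fun ω j => (ζ ω).maxOn (B j)) (fun _ => P) Q :=
  tendstoInDistribution_pi
    (fun n => iIndepFun_maxOn_empiricalConfig hX.measurable hX.indep n hdisj)
    (iIndepFun_maxOn hζ hB hdisj) fun j => tendstoInDistribution_maxOn hX hζ (hB j) (hfr j)

end Joint

/-! ### The height and the time of the maximum -/

section

variable {Ω Ω' : Type*} [MeasurableSpace Ω] [MeasurableSpace Ω']
  {P : Measure Ω} [IsProbabilityMeasure P] {Q : Measure Ω'} [IsProbabilityMeasure Q]
  {X : (n : ℕ) → Fin n → Ω → ℝ} {μ : FiniteMeasure I} {γ : Measure ℝ} [SFinite γ]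
  {ζ : Ω' → Config}

theorem tendstoInDistribution_height (hX : IsNullArray P X μ (fun a => γ.real (Ici a)))
    (hζ : IsPoissonProcess Q ζ ((μ : Measure I).prod γ)) :
    TendstoInDistribution (fun n ω => ⨆ i, X n i ω) atTop (fun ω => (ζ ω).height)
      (fun _ => P) Q := by
  refine (tendstoInDistribution_maxOn hX hζ MeasurableSet.univ (by simp)).congr
    (fun n => Eventually.of_forall fun ω => ?_) (Eventually.of_forall fun ω => ?_)
  · change _ = ⨆ i, X n i ω
    rw [iSup_eq_height_empiricalConfig fun i => hX.nonneg n i ω, Config.height_eq_maxOn]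
  · exact ((ζ ω).height_eq_maxOn).symm

/-- Every nonempty row gives a probability measure, and total mass passes to the weak limit. -/
theorem mass_eq_one {c : (n : ℕ) → Fin n → ℝ} (hc_pos : ∀ n i, 0 < c n i)
    (hμ : Tendsto (weightMeasure c) atTop (𝓝 μ)) : μ.mass = 1 := by
  classical
  refine tendsto_nhds_unique hμ.mass (tendsto_const_nhds.congr' ?_)
  filter_upwards [eventually_gt_atTop 0] with n hn
  rw [← NNReal.coe_inj, FiniteMeasure.mass, measureReal_weightMeasure hc_pos n univ .univ]
  simp only [mem_univ, Finset.filter_true, ← Finset.sum_div]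
  exact (div_self (rowSum_pos hc_pos ⟨0, hn⟩).ne').symm

theorem tendsto_measureReal_Ici_atTop {γ : Measure ℝ} (hγ_pos : γ (Iic 0) = 0)
    (hγ_finite : ∀ t : ℝ, 0 < t → γ (Ici t) < ∞) (hγ : γ univ = ∞) :
    Tendsto (fun n : ℕ => γ.real (Ici (1 / ((n : ℝ) + 1)))) atTop atTop := by
  have hmono : Monotone fun n : ℕ => Ici (1 / ((n : ℝ) + 1)) := fun m n hmn =>
    Ici_subset_Ici.2 (one_div_le_one_div_of_le (by positivity) (by gcongr))
  have hunion : ⋃ n : ℕ, Ici (1 / ((n : ℝ) + 1)) = Ioi 0 := by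
    ext x
    simp only [mem_iUnion, mem_Ici, mem_Ioi]
    refine ⟨fun ⟨n, hn⟩ => lt_of_lt_of_le (by positivity) hn, fun hx => ?_⟩
    obtain ⟨n, hn⟩ := exists_nat_one_div_lt hx
    exact ⟨n, hn.le⟩
  have htop : γ (Ioi 0) = ∞ := by
    have := measure_union_le (μ := γ) (Iic 0) (Ioi 0)
    rw [Iic_union_Ioi, hγ, hγ_pos, zero_add, top_le_iff] at this
    exact this
  have hlim := tendsto_measure_iUnion_atTop (μ := γ) hmono
  rw [hunion, htop] at hlim
  refine tendsto_atTop.2 fun M => ?_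
  filter_upwards [hlim.eventually_const_lt (ENNReal.ofReal_lt_top (r := M))] with n hn
  exact (ENNReal.ofReal_le_iff_le_toReal (hγ_finite _ (by positivity)).ne).1 hn.le

/-- If `γ` is infinite, the law of the maximum over a set of positive measure has no atoms. -/
theorem measure_maxOn_eq_zero (hζ : IsPoissonProcess Q ζ ((μ : Measure I).prod γ))
    (hγ_noAtoms : ∀ x, γ {x} = 0) (hγ_pos : γ (Iic 0) = 0)
    (hγ_finite : ∀ t : ℝ, 0 < t → γ (Ici t) < ∞) (hγ : γ univ = ∞) {B : Set I}
    (hB : MeasurableSet B) (hμB : 0 < μ B) (x : ℝ) : Q {ω | (ζ ω).maxOn B = x} = 0 := by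
  rcases lt_trichotomy x 0 with hx | rfl | hx
  · have : {ω | (ζ ω).maxOn B = x} = ∅ := Set.eq_empty_of_forall_notMem fun ω hω =>
      absurd ((ζ ω).maxOn_nonneg B) (not_le.2 (lt_of_eq_of_lt hω hx))
    rw [this, measure_empty]
  -- At `x = 0`: a zero maximum lies below every level `1 / (n + 1)`, an event of probability `exp
  -- (-μ(B) γ[1/(n+1),∞))`, which tends to `0` because `γ` is infinite near `0`.
  · rw [← measureReal_eq_zero_iff]
    refine le_antisymm ?_ measureReal_nonneg
    have hlim : Tendsto (fun n : ℕ => Real.exp (-(μ B * γ.real (Ici (1 / ((n : ℝ) + 1))))))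
        atTop (𝓝 0) :=
      Real.tendsto_exp_neg_atTop_nhds_zero.comp
        ((tendsto_measureReal_Ici_atTop hγ_pos hγ_finite hγ).const_mul_atTop
          (NNReal.coe_pos.2 hμB))
    refine ge_of_tendsto hlim (Eventually.of_forall fun n => ?_)
    have hn : (0 : ℝ) < 1 / ((n : ℝ) + 1) := by positivity
    rw [← measureReal_maxOn_lt hζ hB hn]
    exact measureReal_mono fun ω hω => lt_of_eq_of_lt hω hn
  -- At `x > 0`: the maximum is attained, so there is a point on `B ×ˢ {x}`, a set of zero
  -- intensity.
  · have hC : IsBoundedBorel (B ×ˢ {x}) :=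
      ⟨hB.prod (measurableSet_singleton x), x, hx, fun p hp => (mem_singleton_iff.1 hp.2).ge⟩
    have h0 : ((μ : Measure I).prod γ).real (B ×ˢ {x}) = 0 := by
      rw [measureReal_def, Measure.prod_prod, hγ_noAtoms, mul_zero, ENNReal.toReal_zero]
    have hle := measureReal_one_le_count_le hζ hC
    rw [h0] at hle
    have hzero := (measureReal_eq_zero_iff).1 (le_antisymm hle measureReal_nonneg)
    refine measure_mono_null (fun ω hω => ?_) hzero
    have hω : (ζ ω).maxOn B = x := hω
    obtain ⟨s, hs, hsx⟩ := Config.exists_mem_of_maxOn_pos (κ := ζ ω) (B := B) (hω ▸ hx)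
    have hfin : ((ζ ω).carrier ∩ B ×ˢ {x}).Finite :=
      ((ζ ω).locallyFinite x hx).subset fun p hp => ⟨hp.1, (mem_singleton_iff.1 hp.2.2).ge⟩
    exact (Set.ncard_pos hfin).2 ⟨_, hsx, hs, hω⟩

/-- Fubini on the diagonal: the joint law is a product, and one factor has no atoms. -/
theorem measure_eq_of_indepFun {S : Type*} [MeasurableSpace S] {ρ : Measure S}
    [IsFiniteMeasure ρ] {f g : S → ℝ} (hf : Measurable f) (hg : Measurable g)
    (hfg : IndepFun f g ρ) (h : ∀ x, ρ {s | g s = x} = 0) : ρ {s | f s = g s} = 0 := by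
  have hdiag : MeasurableSet {p : ℝ × ℝ | p.1 = p.2} :=
    measurableSet_eq_fun measurable_fst measurable_snd
  have hmap := (indepFun_iff_map_prod_eq_prod_map_map hf.aemeasurable hg.aemeasurable).1 hfg
  have h1 : ρ {s | f s = g s} = (ρ.map fun s => (f s, g s)) {p | p.1 = p.2} :=
    (Measure.map_apply (hf.prodMk hg) hdiag).symm
  rw [h1, hmap, Measure.measure_prod_null hdiag]
  refine Eventually.of_forall fun x => ?_
  change (ρ.map g) {y | x = y} = 0
  rw [Measure.map_apply hg
    (measurableSet_eq_fun measurable_const measurable_id : MeasurableSet {y : ℝ | x = y})]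
  simpa only [preimage_ofPred_eq, eq_comm] using h x

theorem measurable_argmaxIndex (n : ℕ) : Measurable (argmaxIndex : (Fin n → ℝ) → ℕ) := by
  classical
  rcases n.eq_zero_or_pos with rfl | hn
  · exact measurable_const' fun x y => congrArg _ (Subsingleton.elim x y)
  · have hne : ∀ x : Fin n → ℝ,
        ∃ j, j ∈ {j : ℕ | ∃ i : Fin n, j = (i : ℕ) + 1 ∧ ∀ k, x k ≤ x i} := by
      intro x
      obtain ⟨m, -, hm⟩ := Finset.exists_max_image Finset.univ x ⟨⟨0, hn⟩, Finset.mem_univ _⟩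
      exact ⟨_, m, rfl, fun k => hm k (Finset.mem_univ _)⟩
    have heq : (argmaxIndex : (Fin n → ℝ) → ℕ) = fun x => Nat.find (hne x) := by
      funext x
      convert Nat.sInf_def (hne x)
      rfl
    rw [heq]
    refine measurable_find _ fun j => ?_
    have : {x : Fin n → ℝ | j ∈ {j : ℕ | ∃ i : Fin n, j = (i : ℕ) + 1 ∧ ∀ k, x k ≤ x i}} =
        ⋃ i : Fin n, {x | j = (i : ℕ) + 1} ∩ ⋂ k, {x : Fin n → ℝ | x k ≤ x i} := by
      ext x
      simp
    rw [this]
    exact MeasurableSet.iUnion fun i => (MeasurableSet.const _).inter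
      (MeasurableSet.iInter fun k =>
        measurableSet_le (measurable_pi_apply k) (measurable_pi_apply i))

theorem argmaxTime_nonneg (κ : Config) : 0 ≤ κ.argmaxTime := by
  refine Real.sInf_nonneg ?_
  rintro _ ⟨s, rfl, _⟩
  exact s.2.1

omit [IsProbabilityMeasure Q] [SFinite γ] in
theorem measurable_argmaxTime (hζ : IsPoissonProcess Q ζ ((μ : Measure I).prod γ)) :
    Measurable fun ω => (ζ ω).argmaxTime := by
  refine measurable_of_Iio fun t => ?_
  rcases le_or_gt t 0 with ht | ht
  · have : (fun ω => (ζ ω).argmaxTime) ⁻¹' Iio t = ∅ := Set.eq_empty_of_forall_notMem fun ω hω =>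
      absurd (argmaxTime_nonneg (ζ ω)) (not_le.2 (lt_of_lt_of_le hω ht))
    rw [this]
    exact MeasurableSet.empty
  · have : (fun ω => (ζ ω).argmaxTime) ⁻¹' Iio t =
        {ω | (ζ ω).maxOn {s | t ≤ (s : ℝ)} ≤ (ζ ω).maxOn {s | (s : ℝ) < t}} := by
      ext ω
      exact Config.argmaxTime_lt_iff ht
    rw [this]
    exact measurableSet_le
      (measurable_maxOn hζ (measurableSet_le measurable_const measurable_subtype_coe))
      (measurable_maxOn hζ (measurableSet_lt measurable_subtype_coe measurable_const))

theorem tendsto_measure_argmax_lt (hX : IsNullArray P X μ (fun a => γ.real (Ici a)))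
    (hζ : IsPoissonProcess Q ζ ((μ : Measure I).prod γ)) (hμ : μ.mass = 1)
    (hγ_noAtoms : ∀ x, γ {x} = 0) (hγ_pos : γ (Iic 0) = 0)
    (hγ_finite : ∀ t : ℝ, 0 < t → γ (Ici t) < ∞) (hγ : γ univ = ∞) {t : ℝ} (ht : 0 < t)
    (hμt : μ {s : I | (s : ℝ) = t} = 0) :
    Tendsto (fun n => P {ω | (argmaxIndex (fun i => X n i ω) : ℝ) / n < t}) atTop
      (𝓝 (Q {ω | (ζ ω).argmaxTime < t})) := by
  set B : Fin 2 → Set I := ![{s | (s : ℝ) < t}, {s | t ≤ (s : ℝ)}] with hBdef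
  have hB : ∀ i, MeasurableSet (B i) := by
    intro i
    fin_cases i
    · exact measurableSet_lt measurable_subtype_coe measurable_const
    · exact measurableSet_le measurable_const measurable_subtype_coe
  have hd01 : Disjoint (B 0) (B 1) := Set.disjoint_left.2 fun s (hs : (s : ℝ) < t)
    (hs' : t ≤ (s : ℝ)) => absurd hs' (not_le.2 hs)
  have hdisj : Pairwise fun i j => Disjoint (B i) (B j) := by
    intro i j hij
    fin_cases i <;> fin_cases j <;> first | exact absurd rfl hij | exact hd01 | exact hd01.symm
  have hfr : ∀ i, μ (frontier (B i)) = 0 := by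
    intro i
    rw [← le_zero_iff, ← hμt]
    fin_cases i
    · exact μ.apply_mono (frontier_lt_subset_eq continuous_subtype_val continuous_const)
    · refine μ.apply_mono
        ((frontier_le_subset_eq continuous_const continuous_subtype_val).trans ?_)
      exact fun s hs => (Eq.symm hs : (s : ℝ) = t)
  have hjoint := tendstoInDistribution_maxOn_pi hX hζ hB hdisj hfr
  have hmeasQ : ∀ i, Measurable fun ω => (ζ ω).maxOn (B i) := fun i => measurable_maxOn hζ (hB i)
  have hEcl : IsClosed {v : Fin 2 → ℝ | v 1 ≤ v 0} :=
    isClosed_le (continuous_apply 1) (continuous_apply 0)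
  have hindep := (iIndepFun_maxOn hζ hB hdisj).indepFun (i := 0) (j := 1) (by decide)
  -- The masses of `B 0` and `B 1` add up to `1`, so at least one is positive; the maximum over that
  -- set has a diffuse law.
  have htie : Q {ω | (ζ ω).maxOn (B 0) = (ζ ω).maxOn (B 1)} = 0 := by
    have hsum : μ (B 0) + μ (B 1) = 1 := by
      have hunion : B 0 ∪ B 1 = univ := eq_univ_of_forall fun s => lt_or_ge (s : ℝ) t
      rw [← hμ, FiniteMeasure.mass, ← hunion, ← ENNReal.coe_inj, ENNReal.coe_add]
      simp only [FiniteMeasure.ennreal_coeFn_eq_coeFn_toMeasure]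
      exact (measure_union hd01 (hB 1)).symm
    rcases (zero_le (a := μ (B 1))).eq_or_lt with h1 | h1
    · have h0 : 0 < μ (B 0) := by
        rw [← h1, add_zero] at hsum
        rw [hsum]
        exact one_pos
      have := measure_eq_of_indepFun (hmeasQ 1) (hmeasQ 0) hindep.symm
        (measure_maxOn_eq_zero hζ hγ_noAtoms hγ_pos hγ_finite hγ (hB 0) h0)
      simpa only [eq_comm] using this
    · exact measure_eq_of_indepFun (hmeasQ 0) (hmeasQ 1) hindep
        (measure_maxOn_eq_zero hζ hγ_noAtoms hγ_pos hγ_finite hγ (hB 1) h1)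
  have hmeasV : Measurable fun ω i => (ζ ω).maxOn (B i) := measurable_pi_lambda _ hmeasQ
  have hfrE : (Q.map fun ω i => (ζ ω).maxOn (B i)) (frontier {v : Fin 2 → ℝ | v 1 ≤ v 0}) = 0 := by
    refine measure_mono_null (frontier_le_subset_eq (continuous_apply 1) (continuous_apply 0)) ?_
    rw [Measure.map_apply hmeasV
      (measurableSet_eq_fun (measurable_pi_apply 1) (measurable_pi_apply 0))]
    simpa only [preimage_ofPred_eq, eq_comm] using htie
  have hlim := ProbabilityMeasure.tendsto_measure_of_null_frontier_of_tendsto' hjoint.tendsto hfrE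
  have hQ : (Q.map fun ω i => (ζ ω).maxOn (B i)) {v : Fin 2 → ℝ | v 1 ≤ v 0} =
      Q {ω | (ζ ω).argmaxTime < t} := by
    rw [Measure.map_apply hmeasV hEcl.measurableSet]
    congr 1
    ext ω
    exact (Config.argmaxTime_lt_iff ht).symm
  rw [← hQ]
  refine hlim.congr' ?_
  obtain ⟨N, hN⟩ := exists_nat_one_div_lt ht
  filter_upwards [eventually_ge_atTop (N + 1)] with n hn
  have hgrid : ∃ i : Fin n, (gridPoint n i : ℝ) < t := by
    refine ⟨⟨0, by omega⟩, lt_of_le_of_lt ?_ hN⟩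
    have : (N : ℝ) + 1 ≤ n := by exact_mod_cast hn
    simp only [gridPoint, Nat.cast_zero, zero_add]
    gcongr
  change (P.map fun ω j => (empiricalConfig fun i => X n i ω).maxOn (B j)) _ = _
  rw [Measure.map_apply_of_aemeasurable (hjoint.forall_aemeasurable n) hEcl.measurableSet]
  congr 1
  ext ω
  exact (argmaxIndex_div_lt_iff (fun i => hX.nonneg n i ω) hgrid).symm

theorem tendstoInDistribution_argmax (hX : IsNullArray P X μ (fun a => γ.real (Ici a)))
    (hζ : IsPoissonProcess Q ζ ((μ : Measure I).prod γ)) (hμ : μ.mass = 1)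
    (hγ_noAtoms : ∀ x, γ {x} = 0) (hγ_pos : γ (Iic 0) = 0)
    (hγ_finite : ∀ t : ℝ, 0 < t → γ (Ici t) < ∞) (hγ : γ univ = ∞) :
    TendstoInDistribution (fun n ω => (argmaxIndex (fun i => X n i ω) : ℝ) / n) atTop
      (fun ω => (ζ ω).argmaxTime) (fun _ => P) Q := by
  have hmeas : ∀ n, Measurable fun ω => (argmaxIndex (fun i => X n i ω) : ℝ) / n := fun n =>
    (measurable_from_nat.comp
      ((measurable_argmaxIndex n).comp (measurable_row hX.measurable n))).div_const _
  refine ⟨fun n => (hmeas n).aemeasurable, (measurable_argmaxTime hζ).aemeasurable, ?_⟩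
  -- Only countably many times carry `μ`-mass; at all other levels `t` the splitting of `[0,1]` at
  -- `t` is into continuity sets.
  have hcount : {t : ℝ | 0 < (μ : Measure I) {s : I | (s : ℝ) = t}}.Countable :=
    Measure.countable_meas_level_set_pos measurable_subtype_coe
  refine tendsto_of_tendsto_Iio (hcount.dense_compl ℝ) fun t ht => ?_
  have := Measure.isProbabilityMeasure_map (μ := Q) (measurable_argmaxTime hζ).aemeasurable
  refine (ENNReal.tendsto_toNNReal
    (measure_ne_top (Q.map fun ω => (ζ ω).argmaxTime) (Iio t))).comp ?_
  change Tendsto (fun n => (P.map fun ω => (argmaxIndex (fun i => X n i ω) : ℝ) / n) (Iio t))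
    atTop (𝓝 ((Q.map fun ω => (ζ ω).argmaxTime) (Iio t)))
  simp_rw [Measure.map_apply (hmeas _) measurableSet_Iio]
  rw [Measure.map_apply (measurable_argmaxTime hζ) measurableSet_Iio]
  rcases le_or_gt t 0 with ht0 | ht0
  · have h1 : ∀ n, (fun ω => (argmaxIndex (fun i => X n i ω) : ℝ) / n) ⁻¹' Iio t = ∅ := fun n =>
      Set.eq_empty_of_forall_notMem fun ω hω => absurd (lt_of_lt_of_le hω ht0)
        (not_lt.2 (by positivity))
    have h2 : (fun ω => (ζ ω).argmaxTime) ⁻¹' Iio t = ∅ :=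
      Set.eq_empty_of_forall_notMem fun ω hω => absurd (lt_of_lt_of_le hω ht0)
        (not_lt.2 (argmaxTime_nonneg _))
    simp only [h1, h2, measure_empty, tendsto_const_nhds]
  · refine tendsto_measure_argmax_lt hX hζ hμ hγ_noAtoms hγ_pos hγ_finite hγ ht0 ?_
    have h0 : (μ : Measure I) {s : I | (s : ℝ) = t} = 0 := by simpa using ht
    rw [FiniteMeasure.coeFn_def]
    simp [h0]

end

/-! ### Time changes of the unit interval -/

theorem ramp_mono {u v : ℝ} (huv : u < v) : Monotone (ramp u v) := fun x y hxy =>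
  max_le_max le_rfl (min_le_min le_rfl
    (div_le_div_of_nonneg_right (by linarith) (by linarith)))

theorem ramp_lt_ramp {u v x y : ℝ} (hux : u ≤ x) (hxv : x < v) (hxy : x < y) :
    ramp u v x < ramp u v y := by
  have hvu : 0 < v - u := by linarith
  have hx0 : 0 ≤ (x - u) / (v - u) := div_nonneg (by linarith) hvu.le
  have hx1 : (x - u) / (v - u) < 1 := by
    rw [div_lt_one hvu]
    linarith
  rw [ramp, min_eq_right hx1.le, max_eq_right hx0]
  refine lt_of_lt_of_le (lt_min hx1 ?_) (le_max_right _ _)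
  gcongr

/-- There is an increasing bijection of `[0,1]` that carries the nodes `a 0 < ⋯ < a k` to the
equidistant ones, provided that `a (i + 1)` lies in `(i / k, (i + 1) / k]`. -/
theorem exists_orderIso_of_nodes {k : ℕ} (hk : 0 < k) {a : ℕ → ℝ} (ha0 : a 0 = 0) (hak : a k = 1)
    (hle : ∀ i ≤ k, a i ≤ i / k) (hlt : ∀ i < k, (i : ℝ) / k < a (i + 1)) :
    ∃ φ : I ≃o I, (∀ i ≤ k, ∀ t : I, (t : ℝ) = a i → (φ t : ℝ) = i / k) ∧
      ∀ t, |(φ t : ℝ) - t| ≤ 2 / k := by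
  have hk' : (0 : ℝ) < k := Nat.cast_pos.2 hk
  have hstep : ∀ j < k, a j < a (j + 1) := fun j hj => (hle j hj.le).trans_lt (hlt j hj)
  have hmono : ∀ i j, i ≤ j → j ≤ k → a i ≤ a j := by
    intro i j hij
    induction j, hij using Nat.le_induction with
    | base => exact fun _ => le_rfl
    | succ j hij ih => exact fun hj => (ih (by omega)).trans (hstep j (by omega)).le
  -- The piecewise affine interpolation: each ramp climbs from `0` to `1` between consecutive nodes,
  -- so `f` gains `1 / k` there.
  set f : ℝ → ℝ := fun t => (∑ j ∈ Finset.range k, ramp (a j) (a (j + 1)) t) / k with hf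
  have hfcont : Continuous f :=
    (continuous_finsetSum _ fun j _ => continuous_ramp _ _).div_const _
  have hfmono : Monotone f := fun x y hxy => by
    simp only [hf]
    gcongr with j hj
    exact ramp_mono (hstep j (Finset.mem_range.1 hj)) hxy
  have hfa : ∀ i ≤ k, f (a i) = i / k := by
    intro i hi
    have hterm : ∀ j ∈ Finset.range k,
        ramp (a j) (a (j + 1)) (a i) = if j < i then 1 else 0 := by
      intro j hj
      have hj := Finset.mem_range.1 hj
      split_ifs with hji
      · exact ramp_of_ge (hstep j hj) (hmono _ _ hji hi)
      · exact ramp_of_le (hstep j hj) (hmono _ _ (not_lt.1 hji) hj.le)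
    have hfilter : (Finset.range k).filter (· < i) = Finset.range i := by
      ext j
      simp only [Finset.mem_filter, Finset.mem_range]
      omega
    simp only [hf]
    rw [Finset.sum_congr rfl hterm, ← Finset.sum_filter, hfilter]
    simp
  have hloc : ∀ t : ℝ, 0 ≤ t → t < 1 → ∃ j < k, a j ≤ t ∧ t < a (j + 1) := by
    intro t ht0 ht1
    classical
    have hex : ∃ i, t < a i := ⟨k, by rwa [hak]⟩
    have hpos : 0 < Nat.find hex := by
      rw [Nat.find_pos, ha0]
      exact not_lt.2 ht0
    have hfk : Nat.find hex ≤ k := Nat.find_min' hex (by rwa [hak])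
    refine ⟨Nat.find hex - 1, by omega, ?_, ?_⟩
    · exact not_lt.1 (Nat.find_min hex (by omega))
    · have := Nat.find_spec hex
      rwa [← Nat.sub_add_cancel hpos] at this
  have hf0 : f 0 = 0 := by simpa [ha0] using hfa 0 (Nat.zero_le k)
  have hf1 : f 1 = 1 := by
    have := hfa k le_rfl
    rwa [hak, div_self hk'.ne'] at this
  have hfI : ∀ t : I, f t ∈ I := fun t =>
    ⟨hf0 ▸ hfmono t.2.1, hf1 ▸ hfmono t.2.2⟩
  let g : I → I := fun t => ⟨f t, hfI t⟩
  have hgmono : StrictMono g := by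
    intro t u htu
    have htu : (t : ℝ) < u := htu
    obtain ⟨j, hj, hjt, htj⟩ := hloc t t.2.1 (htu.trans_le u.2.2)
    change f t < f u
    simp only [hf]
    refine div_lt_div_of_pos_right ?_ hk'
    refine Finset.sum_lt_sum
      (fun i hi => ramp_mono (hstep i (Finset.mem_range.1 hi)) htu.le)
      ⟨j, Finset.mem_range.2 hj, ramp_lt_ramp hjt htj htu⟩
  have hgsurj : Function.Surjective g := by
    intro u
    obtain ⟨t, ht, htu⟩ := intermediate_value_Icc zero_le_one hfcont.continuousOn
      (show (u : ℝ) ∈ Icc (f 0) (f 1) by rw [hf0, hf1]; exact u.2)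
    exact ⟨⟨t, ht⟩, Subtype.ext htu⟩
  refine ⟨StrictMono.orderIsoOfSurjective g hgmono hgsurj, fun i hi t ht => ?_, fun t => ?_⟩
  · change f t = i / k
    rw [ht, hfa i hi]
  · change |f t - t| ≤ 2 / k
    rcases t.2.2.lt_or_eq with ht1 | ht1
    -- Between `a j` and `a (j + 1)`, `f t` lies in `[j / k, (j + 1) / k]` and `t` in `[(j - 1) / k,
    -- (j + 1) / k]`, whence the constant `2 / k`.
    · obtain ⟨j, hj, hjt, htj⟩ := hloc t t.2.1 ht1
      have h1 : (j : ℝ) / k ≤ f t := hfa j hj.le ▸ hfmono hjt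
      have h2 : f t ≤ ((j : ℝ) + 1) / k := by
        have := hfmono htj.le
        rw [hfa (j + 1) hj] at this
        exact_mod_cast this
      have h3 : (t : ℝ) ≤ ((j : ℝ) + 1) / k := by
        have := htj.le.trans (hle (j + 1) hj)
        exact_mod_cast this
      have h4 : ((j : ℝ) - 1) / k ≤ t := by
        refine le_trans ?_ hjt
        rcases j with _ | j
        · rw [ha0]
          exact div_nonpos_of_nonpos_of_nonneg (by simp) hk'.le
        · have := (hlt j (by omega)).le
          push_cast
          rwa [add_sub_cancel_right]
      rw [add_div] at h2 h3
      rw [sub_div] at h4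
      have h5 : (2 : ℝ) / k = 1 / k + 1 / k := by ring
      rw [h5, abs_le]
      constructor <;> linarith
    · rw [ht1, hf1, sub_self, abs_zero]
      positivity

/-! ### Discretisation of the ladder -/

/-- The time interval `(i / k, (i + 1) / k]`. -/
def gridCell (k : ℕ) (i : Fin k) : Set I := {s | (i : ℝ) / k < s ∧ (s : ℝ) ≤ ((i : ℝ) + 1) / k}

/-- The times near the ends of `[0,1]` that a time change cannot move to the right. -/
def gridEdge (k : ℕ) : Set I := {s | (s : ℝ) = 0} ∪ {s | 1 - 1 / (k : ℝ) < s}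

theorem exists_mem_gridCell {k : ℕ} (hk : 0 < k) {s : I} (hs : (s : ℝ) ≠ 0) :
    ∃ i, s ∈ gridCell k i := by
  have hk' : (0 : ℝ) < k := Nat.cast_pos.2 hk
  have hs0 : 0 < (s : ℝ) := lt_of_le_of_ne s.2.1 hs.symm
  have hpos : 0 < ⌈(s : ℝ) * k⌉₊ := Nat.ceil_pos.2 (by positivity)
  have hle : ⌈(s : ℝ) * k⌉₊ ≤ k := Nat.ceil_le.2 (by nlinarith [s.2.2])
  -- Cells are open on the left and closed on the right, hence the ceiling minus one; time `0`
  -- belongs to no cell.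
  refine ⟨⟨⌈(s : ℝ) * k⌉₊ - 1, by omega⟩, ?_, ?_⟩
  · rw [div_lt_iff₀ hk']
    exact Nat.lt_ceil.1 (Nat.sub_lt hpos one_pos)
  · rw [le_div_iff₀ hk']
    have : (((⌈(s : ℝ) * k⌉₊ - 1 : ℕ) : ℝ)) + 1 = ⌈(s : ℝ) * k⌉₊ := by
      exact_mod_cast Nat.sub_add_cancel hpos
    change _ ≤ (((⌈(s : ℝ) * k⌉₊ - 1 : ℕ) : ℝ)) + 1
    rw [this]
    exact Nat.le_ceil _

theorem pairwise_disjoint_gridCell (k : ℕ) :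
    Pairwise fun i j => Disjoint (gridCell k i) (gridCell k j) := by
  have key : ∀ i j : Fin k, i < j → Disjoint (gridCell k i) (gridCell k j) := by
    intro i j hij
    refine Set.disjoint_left.2 fun s hs hs' => ?_
    have h1 : ((i : ℝ) + 1) / k ≤ (j : ℝ) / k := by
      gcongr
      exact_mod_cast hij
    exact absurd (hs'.1.trans_le (hs.2.trans h1)) (lt_irrefl _)
  intro i j hij
  rcases lt_or_gt_of_ne hij with h | h
  · exact key i j h
  · exact (key j i h).symm

/-- The points of `κ` of height at least `ε` lie in distinct cells of mesh `1 / k` and away from the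
ends. -/
structure Config.IsSeparated (κ : Config) (k : ℕ) (ε : ℝ) : Prop where
  eq_of_mem_gridCell : ∀ i, ∀ p ∈ κ.carrier, ∀ q ∈ κ.carrier, ε ≤ p.2 → ε ≤ q.2 →
    p.1 ∈ gridCell k i → q.1 ∈ gridCell k i → p = q
  notMem_gridEdge : ∀ p ∈ κ.carrier, ε ≤ p.2 → p.1 ∉ gridEdge k

/-- The ladder of the configuration in which the highest point of every cell is moved to the right
end of the cell. -/
noncomputable def discreteLadder {k : ℕ} (x : Fin k → ℝ) : SkorokhodSpace :=
  (empiricalConfig x).ladder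

theorem edist_ladder_le {κ κ' : Config} (φ : I ≃o I) {r s : ℝ}
    (hφ : ∀ t, |(φ t : ℝ) - t| ≤ r) (h : ∀ t, |κ.ladderFun t - κ'.ladderFun (φ t)| ≤ s) :
    edist κ.ladder κ'.ladder ≤ max (ENNReal.ofReal r) (ENNReal.ofReal s) := by
  refine (iInf_le _ φ).trans (max_le_max (iSup_le fun t => ?_) (iSup_le fun t => ?_))
  · rw [edist_dist]
    exact ENNReal.ofReal_le_ofReal (hφ t)
  · rw [edist_dist]
    exact ENNReal.ofReal_le_ofReal (h t)

/-- As node of a cell take the time of its unique high point, or its right end if there is none. A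
bijection fixes `0` and `1`, which is why the edges must be free of high points: time `0` cannot be
moved, and the node of the last cell must be `1`. -/
theorem Config.IsSeparated.exists_orderIso {κ : Config} {k : ℕ} {ε : ℝ} (hk : 0 < k)
    (h : κ.IsSeparated k ε) :
    ∃ φ : I ≃o I, (∀ p ∈ κ.carrier, ε ≤ p.2 → ∀ i, p.1 ∈ gridCell k i →
      φ p.1 = gridPoint k i) ∧ ∀ t, |(φ t : ℝ) - t| ≤ 2 / k := by
  classical
  have hk' : (0 : ℝ) < k := Nat.cast_pos.2 hk
  have hex : ∀ i : ℕ, ∃ a : ℝ, (∀ hi : i < k, (i : ℝ) / k < a ∧ a ≤ ((i : ℝ) + 1) / k ∧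
      (∀ p ∈ κ.carrier, ε ≤ p.2 → p.1 ∈ gridCell k ⟨i, hi⟩ → (p.1 : ℝ) = a)) ∧
      (i + 1 = k → a = 1) := by
    intro i
    by_cases hp : ∃ hi : i < k, ∃ p ∈ κ.carrier, ε ≤ p.2 ∧ p.1 ∈ gridCell k ⟨i, hi⟩
    · obtain ⟨hi, p, hp, hpε, hpi⟩ := hp
      refine ⟨p.1, fun _ => ⟨hpi.1, hpi.2, fun q hq hqε hqi => ?_⟩, fun hik => ?_⟩
      · rw [h.eq_of_mem_gridCell ⟨i, hi⟩ p hp q hq hpε hqε hpi hqi]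
      · refine absurd (Or.inr ?_) (h.notMem_gridEdge p hp hpε)
        have h1 : (i : ℝ) / k < (p.1 : ℝ) := hpi.1
        have h2 : (i : ℝ) + 1 = k := by exact_mod_cast hik
        have h3 : 1 - 1 / (k : ℝ) = i / k := by
          field_simp
          linarith
        change 1 - 1 / (k : ℝ) < p.1
        rwa [h3]
    · push Not at hp
      refine ⟨((i : ℝ) + 1) / k, fun hi => ⟨by gcongr; linarith, le_rfl,
        fun p hpκ hpε hpi => absurd hpi (hp hi p hpκ hpε)⟩, fun hik => ?_⟩
      have h2 : (i : ℝ) + 1 = k := by exact_mod_cast hik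
      rw [h2, div_self hk'.ne']
  choose b hb hb1 using hex
  -- The node `a (i + 1)` belongs to cell `i`, and `a 0 = 0` is added in front.
  obtain ⟨φ, hφ, hφt⟩ := exists_orderIso_of_nodes hk (a := fun i => Nat.casesOn i 0 b) rfl
    (by obtain ⟨m, rfl⟩ := Nat.exists_eq_succ_of_ne_zero hk.ne'; exact hb1 m rfl)
    (fun i hi => by
      rcases i with _ | i
      · simp
      · have := (hb i hi).2.1
        push_cast
        exact this)
    (fun i hi => (hb i hi).1)
  refine ⟨φ, fun p hp hpε i hpi => Subtype.ext ?_, hφt⟩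
  rw [hφ (i + 1) i.2 p.1 ((hb i i.2).2.2 p hp hpε hpi)]
  simp [gridPoint]

/-- The Skorokhod distance of the ladder of a separated configuration to its discretisation. -/
theorem Config.IsSeparated.edist_ladder_le {κ : Config} {k : ℕ} {ε : ℝ} (hk : 0 < k) (hε : 0 ≤ ε)
    (h : κ.IsSeparated k ε) :
    edist κ.ladder (discreteLadder fun i => κ.maxOn (gridCell k i)) ≤
      max (ENNReal.ofReal (2 / k)) (ENNReal.ofReal ε) := by
  obtain ⟨φ, hφ, hφt⟩ := h.exists_orderIso hk
  refine Ladder.edist_ladder_le φ hφt fun t => ?_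
  rw [ladderFun_eq_maxOn, ladderFun_eq_maxOn]
  set y : Fin k → ℝ := fun i => κ.maxOn (gridCell k i) with hy
  -- Points below `ε` cost at most `ε`. A high point moves exactly to the right end of its cell, and
  -- `φ` preserves order, so it counts from `t` on precisely when its image counts from `φ t` on.
  have h1 : κ.maxOn (Ici t) ≤ (empiricalConfig y).maxOn (Ici (φ t)) + ε := by
    have hnn := (empiricalConfig y).maxOn_nonneg (Ici (φ t))
    refine (maxOn_le_iff (by linarith)).2 fun p hp hpt => ?_
    rcases lt_or_ge p.2 ε with hpε | hpε
    · linarith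
    · obtain ⟨i, hi⟩ := exists_mem_gridCell hk
        (fun h0 => h.notMem_gridEdge p hp hpε (Or.inl h0))
      have hmem : gridPoint k i ∈ Ici (φ t) := by
        rw [← hφ p hp hpε i hi]
        exact φ.monotone hpt
      have h2 : p.2 ≤ y i := le_maxOn hp hi
      have h3 := le_maxOn_empiricalConfig (x := y) hmem
      linarith
  have h2 : (empiricalConfig y).maxOn (Ici (φ t)) ≤ κ.maxOn (Ici t) + ε := by
    have hnn := κ.maxOn_nonneg (Ici t)
    refine (maxOn_empiricalConfig_le_iff (by linarith)).2 fun i hi =>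
      (maxOn_le_iff (by linarith)).2 fun p hp hpi => ?_
    rcases lt_or_ge p.2 ε with hpε | hpε
    · linarith
    · rw [← hφ p hp hpε i hpi] at hi
      have h3 := le_maxOn (B := Ici t) hp (φ.le_iff_le.1 hi)
      linarith
  rw [abs_le]
  constructor <;> linarith

/-- The jump times are confined to a fixed grid, so the identity time change suffices. -/
theorem continuous_discreteLadder (k : ℕ) :
    Continuous (discreteLadder : (Fin k → ℝ) → SkorokhodSpace) := by
  refine LipschitzWith.continuous (K := 1) fun x y => ?_
  refine (edist_ladder_le (OrderIso.refl I) (r := 0) (s := dist x y) (fun t => by simp)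
    fun t => ?_).trans ?_
  · exact abs_maxOn_empiricalConfig_sub_le (fun i => dist_le_pi_dist x y i) dist_nonneg _
  · rw [ENNReal.ofReal_zero, ENNReal.coe_one, one_mul, edist_dist]
    exact max_le zero_le le_rfl

/-! ### Approximation and convergence in distribution -/

section

variable {E : Type*} [PseudoEMetricSpace E] [MeasurableSpace E] [BorelSpace E]

theorem abs_integral_sub_le {S : Type*} [MeasurableSpace S] {ρ : Measure S}
    [IsProbabilityMeasure ρ] {U V : S → E} (hU : AEMeasurable U ρ) (hV : AEMeasurable V ρ)
    {F : E → ℝ} {C δ : ℝ} {K : ℝ≥0} (hC : ∀ x y, dist (F x) (F y) ≤ C) (hK : LipschitzWith K F)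
    (hδ : 0 ≤ δ) :
    |∫ s, F (U s) ∂ρ - ∫ s, F (V s) ∂ρ| ≤
      K * δ + C * ρ.real {s | ENNReal.ofReal δ ≤ edist (U s) (V s)} := by
  -- `E` is not assumed separable, so this set need not be measurable; it is replaced by a
  -- measurable hull of the same measure.
  set G := toMeasurable ρ {s | ENNReal.ofReal δ ≤ edist (U s) (V s)} with hG
  have hGm : MeasurableSet G := measurableSet_toMeasurable _ _
  have hint : ∀ {W : S → E}, AEMeasurable W ρ → Integrable (fun s => F (W s)) ρ := by
    intro W hW
    have : Nonempty S := ρ.nonempty_of_neZero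
    obtain ⟨s₀⟩ := this
    refine Integrable.of_bound (hK.continuous.measurable.comp_aemeasurable hW).aestronglyMeasurable
      (|F (W s₀)| + C) (Eventually.of_forall fun s => ?_)
    have h1 := hC (W s) (W s₀)
    rw [Real.dist_eq] at h1
    rw [Real.norm_eq_abs]
    have h2 := abs_sub_abs_le_abs_sub (F (W s)) (F (W s₀))
    linarith
  have hbound : ∀ s, |F (U s) - F (V s)| ≤ K * δ + G.indicator (fun _ => C) s := by
    intro s
    have hKδ : 0 ≤ K * δ := mul_nonneg K.2 hδ
    by_cases hs : s ∈ G
    · rw [indicator_of_mem hs]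
      have := hC (U s) (V s)
      rw [Real.dist_eq] at this
      linarith
    · rw [indicator_of_notMem hs, add_zero]
      have hlt : edist (U s) (V s) < ENNReal.ofReal δ :=
        not_le.1 fun h => hs (subset_toMeasurable _ _ h)
      have h1 := (hK (U s) (V s)).trans (mul_le_mul_right hlt.le (K : ℝ≥0∞))
      rw [edist_dist, ← ENNReal.ofReal_coe_nnreal, ← ENNReal.ofReal_mul K.coe_nonneg] at h1
      exact (ENNReal.ofReal_le_ofReal_iff hKδ).1 h1
  have hintR : Integrable (fun s => K * δ + G.indicator (fun _ => C) s) ρ :=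
    (integrable_const _).add ((integrable_const C).indicator hGm)
  rw [← integral_sub (hint hU) (hint hV)]
  calc |∫ s, (F (U s) - F (V s)) ∂ρ| ≤ ∫ s, |F (U s) - F (V s)| ∂ρ := abs_integral_le_integral_abs
    _ ≤ ∫ s, (K * δ + G.indicator (fun _ => C) s) ∂ρ :=
        integral_mono ((hint hU).sub (hint hV)).abs hintR hbound
    _ = K * δ + C * ρ.real {s | ENNReal.ofReal δ ≤ edist (U s) (V s)} := by
        rw [integral_add (integrable_const _) ((integrable_const C).indicator hGm),
          integral_indicator_const _ hGm, integral_const, measureReal_def, measureReal_def,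
          measureReal_def, hG, measure_toMeasurable, measure_univ]
        simp [mul_comm]

/-- Convergence in distribution may be checked on approximations that are uniformly close in
probability. -/
theorem tendstoInDistribution_of_approximation {S S' : Type*} [MeasurableSpace S]
    [MeasurableSpace S'] {P : Measure S} [IsProbabilityMeasure P] {Q : Measure S'}
    [IsProbabilityMeasure Q] {U : ℕ → S → E} {V : S' → E} {U' : ℕ → ℕ → S → E} {V' : ℕ → S' → E}
    (hU : ∀ n, AEMeasurable (U n) P) (h : ∀ k, TendstoInDistribution (U' k) atTop (V' k)
      (fun _ => P) Q)
    (hclose : ∀ ε η : ℝ, 0 < ε → 0 < η → ∀ᶠ k in atTop,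
      (∀ᶠ n in atTop, P.real {s | ENNReal.ofReal ε ≤ edist (U n s) (U' k n s)} ≤ η) ∧
        Q.real {s | ENNReal.ofReal ε ≤ edist (V s) (V' k s)} ≤ η) :
    TendstoInDistribution U atTop V (fun _ => P) Q := by
  -- `V` is the limit in measure of the measurable `V' k`.
  have hV : AEMeasurable V Q := by
    refine TendstoInMeasure.aemeasurable (u := atTop) (fun k => (h k).aemeasurable_limit)
      (tendstoInMeasure_of_ne_top fun ε hε hε' => ?_)
    rw [ENNReal.tendsto_nhds_zero]
    intro η hη
    rcases eq_or_ne η ∞ with rfl | hη'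
    · exact Eventually.of_forall fun _ => le_top
    filter_upwards [hclose ε.toReal η.toReal (ENNReal.toReal_pos hε.ne' hε')
      (ENNReal.toReal_pos hη.ne' hη')] with k hk
    rw [ENNReal.ofReal_toReal hε'] at hk
    simp_rw [edist_comm (V' k _)]
    exact (ENNReal.toReal_le_toReal (measure_ne_top _ _) hη').1 hk.2
  refine ⟨hU, hV, tendsto_iff_forall_lipschitz_integral_tendsto.2 ?_⟩
  rintro F ⟨C, hC⟩ ⟨K, hK⟩
  have hcont := hK.continuous
  have hmapP : ∀ {W : S → E}, AEMeasurable W P → ∫ x, F x ∂(P.map W) = ∫ s, F (W s) ∂P :=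
    fun hW => integral_map hW hcont.measurable.aestronglyMeasurable
  have hmapQ : ∀ {W : S' → E}, AEMeasurable W Q → ∫ x, F x ∂(Q.map W) = ∫ s, F (W s) ∂Q :=
    fun hW => integral_map hW hcont.measurable.aestronglyMeasurable
  change Tendsto (fun n => ∫ x, F x ∂(P.map (U n))) atTop (𝓝 (∫ x, F x ∂(Q.map V)))
  simp_rw [hmapP (hU _)]
  rw [hmapQ hV, Metric.tendsto_nhds]
  intro r hr
  have hC0 : 0 ≤ C := by
    have : Nonempty S := P.nonempty_of_neZero
    obtain ⟨s⟩ := this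
    exact dist_nonneg.trans (hC (U 0 s) (U 0 s))
  -- Each of the two approximations then costs at most `K ε + C η ≤ r / 4`, leaving `r / 2` for the
  -- convergence at fixed `k`; the `+ 1` avoids division by zero.
  set ε := r / (8 * ((K : ℝ) + 1)) with hε
  set η := r / (8 * (C + 1)) with hη
  have hK0 : (0 : ℝ) ≤ K := K.2
  have hε0 : 0 < ε := by positivity
  have hη0 : 0 < η := by positivity
  have hKε : K * ε ≤ r / 8 := by
    rw [hε, ← mul_div_assoc, div_le_div_iff₀ (by positivity) (by positivity)]
    nlinarith
  have hCη : C * η ≤ r / 8 := by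
    rw [hη, ← mul_div_assoc, div_le_div_iff₀ (by positivity) (by positivity)]
    nlinarith
  obtain ⟨k, hkP, hkQ⟩ := (hclose ε η hε0 hη0).exists
  have hlim := tendsto_iff_forall_lipschitz_integral_tendsto.1 (h k).tendsto F ⟨C, hC⟩ ⟨K, hK⟩
  change Tendsto (fun n => ∫ x, F x ∂(P.map (U' k n))) atTop
    (𝓝 (∫ x, F x ∂(Q.map (V' k)))) at hlim
  simp_rw [hmapP ((h k).forall_aemeasurable _)] at hlim
  rw [hmapQ (h k).aemeasurable_limit] at hlim
  filter_upwards [hkP, Metric.tendsto_nhds.1 hlim (r / 2) (half_pos hr)] with n hn hn'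
  have e1 := abs_integral_sub_le (hU n) ((h k).forall_aemeasurable n) hC hK hε0.le
  have e2 := abs_integral_sub_le hV (h k).aemeasurable_limit hC hK hε0.le
  have e3 := mul_le_mul_of_nonneg_left hn hC0
  have e4 := mul_le_mul_of_nonneg_left hkQ hC0
  rw [Real.dist_eq] at hn' ⊢
  have e1 := abs_le.1 (e1.trans (add_le_add hKε (e3.trans hCη)))
  have e2 := abs_le.1 (e2.trans (add_le_add hKε (e4.trans hCη)))
  have hn' := abs_lt.1 hn'
  rw [abs_lt]
  constructor <;> linarith

end

/-! ### Separation with high probability -/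

section Cells

variable {μ : FiniteMeasure I}

/-- Each point is null and so has an open neighbourhood of mass below `η`; compactness gives a
Lebesgue number for this cover. -/
theorem exists_forall_dist_lt_imp_le (hμ : ∀ t : I, (μ : Measure I) {t} = 0) {η : ℝ≥0}
    (hη : 0 < η) : ∃ δ > 0, ∀ B : Set I, (∀ s ∈ B, ∀ t ∈ B, dist s t < δ) → μ B ≤ η := by
  have hopen : ∀ t : I, ∃ U : Set I, t ∈ U ∧ IsOpen U ∧ (μ : Measure I) U < η := by
    intro t
    obtain ⟨U, hU, hUo, hUlt⟩ := Set.exists_isOpen_lt_of_lt ({t} : Set I) (η : ℝ≥0∞)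
      (μ := (μ : Measure I)) (by rw [hμ t]; exact ENNReal.coe_pos.2 hη)
    exact ⟨U, hU rfl, hUo, hUlt⟩
  choose U hUt hUo hUlt using hopen
  obtain ⟨δ, hδ, hball⟩ := lebesgue_number_lemma_of_metric (isCompact_univ (X := I)) hUo
    fun t _ => mem_iUnion.2 ⟨t, hUt t⟩
  refine ⟨δ, hδ, fun B hB => ?_⟩
  rcases B.eq_empty_or_nonempty with rfl | ⟨s, hs⟩
  · simp
  · obtain ⟨t, ht⟩ := hball s (mem_univ s)
    rw [← ENNReal.coe_le_coe, FiniteMeasure.ennreal_coeFn_eq_coeFn_toMeasure]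
    exact (measure_mono fun r hr => ht (Metric.mem_ball.2 (hB r hr s hs))).trans (hUlt t).le

theorem measurableSet_gridCell (k : ℕ) (i : Fin k) : MeasurableSet (gridCell k i) :=
  (measurableSet_lt measurable_const measurable_subtype_coe).inter
    (measurableSet_le measurable_subtype_coe measurable_const)

theorem measurableSet_gridEdge (k : ℕ) : MeasurableSet (gridEdge k) :=
  (measurableSet_eq_fun measurable_subtype_coe measurable_const).union
    (measurableSet_lt measurable_const measurable_subtype_coe)

theorem measure_coe_eq_zero (hμ : ∀ t : I, (μ : Measure I) {t} = 0) (x : ℝ) :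
    μ {s : I | (s : ℝ) = x} = 0 := by
  have hsub : {s : I | (s : ℝ) = x}.Subsingleton := fun s hs t ht =>
    Subtype.ext ((show (s : ℝ) = x from hs).trans (show (t : ℝ) = x from ht).symm)
  rw [← ENNReal.coe_inj, FiniteMeasure.ennreal_coeFn_eq_coeFn_toMeasure, ENNReal.coe_zero]
  rcases hsub.eq_empty_or_singleton with h | ⟨t, h⟩
  · rw [h, measure_empty]
  · rw [h, hμ]

theorem measure_eq_zero_of_subset (hμ : ∀ t : I, (μ : Measure I) {t} = 0) {B : Set I} {x y : ℝ}
    (hB : B ⊆ {s : I | (s : ℝ) = x} ∪ {s : I | (s : ℝ) = y}) : μ B = 0 := by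
  refine le_antisymm ((μ.apply_mono hB).trans ((μ.apply_union_le).trans ?_)) zero_le
  rw [measure_coe_eq_zero hμ, measure_coe_eq_zero hμ, add_zero]

theorem measure_frontier_gridCell (hμ : ∀ t : I, (μ : Measure I) {t} = 0) (k : ℕ) (i : Fin k) :
    μ (frontier (gridCell k i)) = 0 := by
  refine measure_eq_zero_of_subset hμ (x := i / k) (y := ((i : ℝ) + 1) / k) ?_
  refine (frontier_inter_subset {s : I | (i : ℝ) / k < s}
    {s : I | (s : ℝ) ≤ ((i : ℝ) + 1) / k}).trans ?_
  refine union_subset_union ?_ ?_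
  · exact fun s hs => Eq.symm (frontier_lt_subset_eq continuous_const continuous_subtype_val hs.1)
  · exact fun s hs => frontier_le_subset_eq continuous_subtype_val continuous_const hs.2

theorem measure_frontier_gridEdge (hμ : ∀ t : I, (μ : Measure I) {t} = 0) (k : ℕ) :
    μ (frontier (gridEdge k)) = 0 := by
  refine measure_eq_zero_of_subset hμ (x := 0) (y := 1 - 1 / (k : ℝ)) ?_
  refine (frontier_union_subset {s : I | (s : ℝ) = 0} {s : I | 1 - 1 / (k : ℝ) < s}).trans ?_
  refine union_subset_union ?_ ?_
  · exact fun s hs =>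
      (isClosed_eq continuous_subtype_val continuous_const).frontier_subset hs.1
  · exact fun s hs => Eq.symm (frontier_lt_subset_eq continuous_const continuous_subtype_val hs.2)

/-- A bound for the probability that a Poisson process with tail `Γ` is not separated. -/
noncomputable def separationBound (μ : FiniteMeasure I) (Γ : ℝ) (k : ℕ) : ℝ :=
  ∑ i : Fin k, (μ (gridCell k i) * Γ) ^ 2 + μ (gridEdge k) * Γ

/-- The sum of squares is at most the largest cell mass times the total mass times `Γ ^ 2`; cells
and edge have small diameter, up to the null time `0`, hence small mass. -/
theorem tendsto_separationBound (hμ : ∀ t : I, (μ : Measure I) {t} = 0) {Γ : ℝ} (hΓ : 0 ≤ Γ) :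
    Tendsto (separationBound μ Γ) atTop (𝓝 0) := by
  have hmain : ∀ η : ℝ≥0, 0 < η → ∀ᶠ k in atTop,
      separationBound μ Γ k ≤ η * (μ.mass * Γ ^ 2 + Γ) := by
    intro η hη
    obtain ⟨δ, hδ, hδB⟩ := exists_forall_dist_lt_imp_le hμ hη
    obtain ⟨N, hN⟩ := exists_nat_one_div_lt hδ
    filter_upwards [eventually_ge_atTop (N + 1)] with k hk
    have hk' : (N : ℝ) + 1 ≤ k := by exact_mod_cast hk
    have hkδ : 1 / (k : ℝ) < δ := lt_of_le_of_lt (by gcongr) hN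
    have hcell : ∀ i, μ (gridCell k i) ≤ η := by
      refine fun i => hδB _ fun s hs t ht => lt_of_le_of_lt ?_ hkδ
      have hs1 := hs.1
      have hs2 := hs.2
      have ht1 := ht.1
      have ht2 := ht.2
      rw [add_div] at hs2 ht2
      rw [Subtype.dist_eq, Real.dist_eq, abs_le]
      constructor <;> linarith
    have hedge : μ (gridEdge k) ≤ η := by
      refine μ.apply_union_le.trans ?_
      rw [measure_coe_eq_zero hμ, zero_add]
      refine hδB _ fun s (hs : 1 - 1 / (k : ℝ) < s) t (ht : 1 - 1 / (k : ℝ) < t) =>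
        lt_of_le_of_lt ?_ hkδ
      rw [Subtype.dist_eq, Real.dist_eq, abs_le]
      constructor <;> linarith [s.2.2, t.2.2]
    have hsum : ∑ i : Fin k, μ (gridCell k i) ≤ μ.mass := by
      rw [← ENNReal.coe_le_coe, ENNReal.ofNNReal_finsetSum, FiniteMeasure.ennreal_mass]
      simp only [FiniteMeasure.ennreal_coeFn_eq_coeFn_toMeasure]
      rw [← measure_biUnion_finset (fun i _ j _ hij => pairwise_disjoint_gridCell k hij)
        fun i _ => measurableSet_gridCell k i]
      exact measure_mono (subset_univ _)
    have hsum' : ∑ i : Fin k, ((μ (gridCell k i) : ℝ≥0) : ℝ) ≤ μ.mass := by exact_mod_cast hsum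
    calc separationBound μ Γ k
        ≤ ∑ i : Fin k, η * (μ (gridCell k i) * Γ ^ 2) + η * Γ := by
          unfold separationBound
          gcongr with i
          · have h1 : ((μ (gridCell k i) : ℝ≥0) : ℝ) ≤ η := by exact_mod_cast hcell i
            calc ((μ (gridCell k i) : ℝ≥0) * Γ) ^ 2
                = μ (gridCell k i) * (μ (gridCell k i) * Γ ^ 2) := by ring
              _ ≤ η * (μ (gridCell k i) * Γ ^ 2) := by gcongr
      _ = η * ((∑ i : Fin k, ((μ (gridCell k i) : ℝ≥0) : ℝ)) * Γ ^ 2 + Γ) := by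
          rw [← Finset.mul_sum, ← Finset.sum_mul]
          ring
      _ ≤ η * (μ.mass * Γ ^ 2 + Γ) := by gcongr
  have hnn : ∀ k, 0 ≤ separationBound μ Γ k := fun k => by unfold separationBound; positivity
  rw [Metric.tendsto_nhds]
  intro r hr
  set D : ℝ := μ.mass * Γ ^ 2 + Γ with hD
  have hD0 : 0 ≤ D := by positivity
  filter_upwards [hmain (r / (2 * (D + 1))).toNNReal (Real.toNNReal_pos.2 (by positivity))]
    with k hk
  rw [dist_zero_right, Real.norm_of_nonneg (hnn k)]
  refine hk.trans_lt ?_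
  rw [Real.coe_toNNReal _ (by positivity), div_mul_eq_mul_div, div_lt_iff₀ (by positivity)]
  nlinarith

end Cells

section Separation

variable {Ω Ω' : Type*} [MeasurableSpace Ω] [MeasurableSpace Ω']
  {P : Measure Ω} [IsProbabilityMeasure P] {Q : Measure Ω'} [IsProbabilityMeasure Q]
  {X : (n : ℕ) → Fin n → Ω → ℝ} {μ : FiniteMeasure I} {γ : Measure ℝ}
  {ζ : Ω' → Config}

/-- Separation fails only if some cell has two points above `ε` or the edge has one. -/
theorem measureReal_not_isSeparated_le [SFinite γ]
    (hζ : IsPoissonProcess Q ζ ((μ : Measure I).prod γ)) (k : ℕ) {ε : ℝ} (hε : 0 < ε) :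
    Q.real {ω | ¬ (ζ ω).IsSeparated k ε} ≤ separationBound μ (γ.real (Ici ε)) k := by
  have hsub : {ω | ¬ (ζ ω).IsSeparated k ε} ⊆
      (⋃ i ∈ (Finset.univ : Finset (Fin k)), {ω | 2 ≤ (ζ ω).count (gridCell k i ×ˢ Ici ε)}) ∪
        {ω | 1 ≤ (ζ ω).count (gridEdge k ×ˢ Ici ε)} := by
    intro ω hω
    by_contra hcon
    simp only [mem_union, mem_iUnion, Finset.mem_univ, exists_true_left, mem_ofPred_eq, not_or,
      not_exists, not_le] at hcon
    refine hω ⟨fun i p hp q hq hpε hqε hpi hqi => ?_, fun p hp hpε hpe => ?_⟩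
    · have hcard : ((ζ ω).carrier ∩ gridCell k i ×ˢ Ici ε).ncard ≤ 1 :=
        Nat.lt_succ_iff.1 (hcon.1 i)
      exact (Set.ncard_le_one (Config.finite_inter_prod_Ici hε)).1 hcard p ⟨hp, hpi, hpε⟩ q
        ⟨hq, hqi, hqε⟩
    · exact absurd ((Set.ncard_pos (Config.finite_inter_prod_Ici hε)).2 ⟨p, hp, hpe, hpε⟩)
        (not_lt.2 (Nat.lt_succ_iff.1 hcon.2))
  have hprod : ∀ B : Set I, ((μ : Measure I).prod γ).real (B ×ˢ Ici ε) = μ B * γ.real (Ici ε) :=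
    fun B => toNNReal_prod_Ici
  refine (measureReal_mono hsub).trans ((measureReal_union_le _ _).trans (add_le_add ?_ ?_))
  · refine (measureReal_biUnion_finset_le _ _).trans (Finset.sum_le_sum fun i _ => ?_)
    rw [← hprod]
    exact measureReal_two_le_count_le hζ (isBoundedBorel_prod_Ici (measurableSet_gridCell k i) hε)
  · rw [← hprod]
    exact measureReal_one_le_count_le hζ (isBoundedBorel_prod_Ici (measurableSet_gridEdge k) hε)

/-- Union bound over pairs of indices in a common cell and over single indices in the edge; the
limit of the bound is the Poisson one because all these sets are `μ`-continuity sets. -/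
theorem IsNullArray.eventually_measureReal_not_isSeparated_le {Γ : ℝ → ℝ}
    (hX : IsNullArray P X μ Γ) (hμ : ∀ t : I, (μ : Measure I) {t} = 0) (k : ℕ) {ε η : ℝ}
    (hε : 0 < ε) (hη : separationBound μ (Γ ε) k < η) :
    ∀ᶠ n in atTop,
      P.real {ω | ¬ (empiricalConfig fun i => X n i ω).IsSeparated k ε} ≤ η := by
  classical
  have hlim : Tendsto (fun n =>
      ∑ i : Fin k, (∑ j with gridPoint n j ∈ gridCell k i, P.real {ω | ε ≤ X n j ω}) ^ 2 +
        ∑ j with gridPoint n j ∈ gridEdge k, P.real {ω | ε ≤ X n j ω}) atTop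
      (𝓝 (separationBound μ (Γ ε) k)) :=
    (tendsto_finsetSum _ fun i _ => (hX.tendsto_sum ε hε _ (measurableSet_gridCell k i)
      (measure_frontier_gridCell hμ k i)).pow 2).add
        (hX.tendsto_sum ε hε _ (measurableSet_gridEdge k) (measure_frontier_gridEdge hμ k))
  filter_upwards [hlim.eventually_lt_const hη] with n hn
  refine le_trans ?_ hn.le
  set J : Fin k → Finset (Fin n) := fun i => {j | gridPoint n j ∈ gridCell k i} with hJ
  have hsub : {ω | ¬ (empiricalConfig fun i => X n i ω).IsSeparated k ε} ⊆
      (⋃ i ∈ (Finset.univ : Finset (Fin k)), ⋃ p ∈ (J i ×ˢ J i).filter fun p => p.1 ≠ p.2,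
        {ω | ε ≤ X n p.1 ω} ∩ {ω | ε ≤ X n p.2 ω}) ∪
      ⋃ j ∈ (Finset.univ.filter fun j => gridPoint n j ∈ gridEdge k), {ω | ε ≤ X n j ω} := by
    intro ω hω
    by_contra hcon
    rw [mem_union, not_or] at hcon
    refine hω ⟨?_, ?_⟩
    · rintro i _ ⟨j, rfl, _⟩ _ ⟨j', rfl, _⟩ hj hj' hji hji'
      by_contra hne
      have hjj : j ≠ j' := by
        rintro rfl
        exact hne rfl
      refine hcon.1 (mem_iUnion₂.2 ⟨i, Finset.mem_univ i, mem_iUnion₂.2 ⟨(j, j'), ?_, hj, hj'⟩⟩)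
      simp only [hJ, Finset.mem_filter, Finset.mem_product, Finset.mem_univ, true_and]
      exact ⟨⟨hji, hji'⟩, hjj⟩
    · rintro _ ⟨j, rfl, _⟩ hj hje
      exact hcon.2 (mem_iUnion₂.2 ⟨j, Finset.mem_filter.2 ⟨Finset.mem_univ j, hje⟩, hj⟩)
  refine (measureReal_mono hsub).trans ((measureReal_union_le _ _).trans
    (add_le_add ?_ (measureReal_biUnion_finset_le _ _)))
  refine (measureReal_biUnion_finset_le _ _).trans (Finset.sum_le_sum fun i _ => ?_)
  calc P.real (⋃ p ∈ (J i ×ˢ J i).filter fun p => p.1 ≠ p.2,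
        {ω | ε ≤ X n p.1 ω} ∩ {ω | ε ≤ X n p.2 ω})
      ≤ ∑ p ∈ (J i ×ˢ J i).filter fun p => p.1 ≠ p.2,
          P.real ({ω | ε ≤ X n p.1 ω} ∩ {ω | ε ≤ X n p.2 ω}) := measureReal_biUnion_finset_le _ _
    _ = ∑ p ∈ (J i ×ˢ J i).filter fun p => p.1 ≠ p.2,
          P.real {ω | ε ≤ X n p.1 ω} * P.real {ω | ε ≤ X n p.2 ω} := by
        refine Finset.sum_congr rfl fun p hp => ?_
        have hind := ((hX.indep n).indepFun (Finset.mem_filter.1 hp).2).measure_inter_preimage_eq_mul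
          (Ici ε) (Ici ε) measurableSet_Ici measurableSet_Ici
        simp only [measureReal_def]
        rw [← ENNReal.toReal_mul]
        exact congrArg _ hind
    -- Restoring the diagonal terms turns the sum over pairs into a square.
    _ ≤ ∑ p ∈ J i ×ˢ J i, P.real {ω | ε ≤ X n p.1 ω} * P.real {ω | ε ≤ X n p.2 ω} :=
        Finset.sum_le_sum_of_subset_of_nonneg (Finset.filter_subset _ _) fun _ _ _ => by positivity
    _ = (∑ j ∈ J i, P.real {ω | ε ≤ X n j ω}) ^ 2 := by
        rw [Finset.sum_product, sq, Finset.sum_mul_sum]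

theorem edist_ladder_lt_of_isSeparated {κ : Config} {k : ℕ} {ε : ℝ} (hε : 0 < ε)
    (hk : 2 / ε < k) (h : κ.IsSeparated k (ε / 2)) :
    edist κ.ladder (discreteLadder fun i => κ.maxOn (gridCell k i)) < ENNReal.ofReal ε := by
  have hk0 : (0 : ℝ) < k := lt_trans (by positivity) hk
  refine (h.edist_ladder_le (Nat.cast_pos.1 hk0) (half_pos hε).le).trans_lt (max_lt ?_ ?_)
  · refine (ENNReal.ofReal_lt_ofReal_iff hε).2 ?_
    rwa [div_lt_comm₀ hk0 hε]
  · exact (ENNReal.ofReal_lt_ofReal_iff hε).2 (half_lt_self hε)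

theorem tendstoInDistribution_ladder [SFinite γ]
    (hX : IsNullArray P X μ (fun a => γ.real (Ici a)))
    (hζ : IsPoissonProcess Q ζ ((μ : Measure I).prod γ))
    (hμ : ∀ t : I, (μ : Measure I) {t} = 0) :
    TendstoInDistribution (fun n ω => (empiricalConfig fun i => X n i ω).ladder) atTop
      (fun ω => (ζ ω).ladder) (fun _ => P) Q := by
  refine tendstoInDistribution_of_approximation
    (U' := fun k n ω => discreteLadder fun i : Fin k =>
      (empiricalConfig fun j => X n j ω).maxOn (gridCell k i))
    (V' := fun k ω => discreteLadder fun i : Fin k => (ζ ω).maxOn (gridCell k i))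
    -- The ladder of row `n` is itself `discreteLadder` of the row with `k = n`, which gives its
    -- measurability.
    (fun n => ((continuous_discreteLadder n).measurable.comp
      (measurable_row hX.measurable n)).aemeasurable)
    (fun k => (tendstoInDistribution_maxOn_pi hX hζ (measurableSet_gridCell k)
      (pairwise_disjoint_gridCell k) (measure_frontier_gridCell hμ k)).continuous_comp
        (g := discreteLadder) (continuous_discreteLadder k)) fun ε η hε hη => ?_
  filter_upwards [(tendsto_separationBound hμ measureReal_nonneg).eventually_lt_const hη,
    tendsto_natCast_atTop_atTop.eventually_gt_atTop (2 / ε)] with k hk hkε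
  constructor
  · filter_upwards [hX.eventually_measureReal_not_isSeparated_le hμ k (half_pos hε) hk] with n hn
    exact (measureReal_mono fun ω hω hsep =>
      absurd (edist_ladder_lt_of_isSeparated hε hkε hsep) (not_lt.2 hω)).trans hn
  · refine le_trans ?_ ((measureReal_not_isSeparated_le hζ k (half_pos hε)).trans hk.le)
    exact measureReal_mono fun ω hω hsep =>
      absurd (edist_ladder_lt_of_isSeparated hε hkε hsep) (not_lt.2 hω)

end Separation

end Ladder

/-! ### The three limit theorems -/

theorem mainTheorem2
    {Ω Ω' : Type*} [MeasurableSpace Ω] [MeasurableSpace Ω']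
    (P : Measure Ω) [IsProbabilityMeasure P] (Q : Measure Ω') [IsProbabilityMeasure Q]
    -- the array `X`, independent within each row, with nonnegative, non-atomic entries
    (X : (n : ℕ) → Fin n → Ω → ℝ)
    (hX_meas : ∀ n i, Measurable (X n i))
    (hX_indep : ∀ n, iIndepFun (X n) P)
    (hX_nonneg : ∀ n i ω, 0 ≤ X n i ω)
    (hX_noAtoms : ∀ n i x, P.map (X n i) {x} = 0)
    -- the array `c` of positive constants and condition `H₁`
    (c : (n : ℕ) → Fin n → ℝ)
    (hc_pos : ∀ n i, 0 < c n i)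
    (hc_sum : Tendsto (Ladder.rowSum c) atTop atTop)
    (hc_max : Tendsto (fun n => (⨆ i, c n i) / Ladder.rowSum c n) atTop (𝓝 0))
    (μ : FiniteMeasure I)
    (hμ : Tendsto (Ladder.weightMeasure c) atTop (𝓝 μ))
    -- the measure `γ` on `(0,∞]`, without atoms (in particular at `+∞`), and condition `H₂`
    (γ : Measure ℝ)
    (hγ_noAtoms : ∀ x, γ {x} = 0)
    (hγ_pos : γ (Iic 0) = 0)
    (hγ_finite : ∀ t : ℝ, 0 < t → γ (Ici t) < ∞)
    (hγ_unif : ∀ t : ℝ, 0 < t → ∀ f ∈ Ladder.testFunctions t,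
      Tendsto (fun n => ⨆ i : Fin n,
          |Ladder.rowSum c n / c n i * ∫ x, f x ∂(P.map (X n i)) - ∫ x, f x ∂γ|)
        atTop (𝓝 0))
    -- the Poisson point process `ζ` with intensity measure `μ × γ`
    (ζ : Ω' → Ladder.Config)
    (hζ : Ladder.IsPoissonProcess Q ζ ((μ : Measure I).prod γ)) :
    (γ univ = ∞ →
      TendstoInDistribution
        (fun n ω => (Ladder.argmaxIndex (fun i => X n i ω) : ℝ) / n) atTop
        (fun ω => (ζ ω).argmaxTime) (fun _ => P) Q) ∧
    TendstoInDistribution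
      (fun n ω => ⨆ i, X n i ω) atTop
      (fun ω => (ζ ω).height) (fun _ => P) Q ∧
    ((∀ t : I, (μ : Measure I) {t} = 0) →
      TendstoInDistribution
        (fun n ω => (Ladder.empiricalConfig (fun i => X n i ω)).ladder) atTop
        (fun ω => (ζ ω).ladder) (fun _ => P) Q) := by
  have : SigmaFinite γ := Ladder.sigmaFinite_of_measure_Ici_lt_top hγ_pos hγ_finite
  have hX := Ladder.isNullArray hX_meas hX_indep hX_nonneg hc_pos hc_max hμ hγ_noAtoms
    hγ_finite hγ_unif
  exact ⟨Ladder.tendstoInDistribution_argmax hX hζ (Ladder.mass_eq_one hc_pos hμ) hγ_noAtoms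
    hγ_pos hγ_finite, Ladder.tendstoInDistribution_height hX hζ,
    Ladder.tendstoInDistribution_ladder hX hζ⟩
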